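/- **Setting.** Let $A$ and $B$ be disjoint finite sets of qubits, $n_A=|A|$, $d=2^{|A|+|B|}$, and let $\mathrm{Pauli}_A$ be the set of the $4^{n_A}$ Pauli strings on $A$ (phases disregarded). A monitored Clifford circuit with $\tau\ge 0$ layers on $AB$ is given by signed Pauli strings $P_1',\dots,P_\tau'$ and Clifford unitaries $U_1,\dots,U_\tau$; layer $j$ measures $P_j'$ with outcome $m_j=\pm1$ and then applies $U_j$. Put $P_j=(U_\tau\cdots U_j)P_j'(U_\tau\cdots U_j)^\dagger$ and $\Pi(m)=\Pi_\tau(m_\tau)\cdots\Pi_1(m_1)$ with $\Pi_j(m_j)=\frac{1}{2}(I+m_jP_j)$. **Dual classical code.** For $P_A\in\mathrm{Pauli}_A$ let $\mathcal C(P_A)\in\{\pm1\}^\tau$ be given by $P_AP_j=\mathcal C(P_A)_jP_jP_A$. Let $\mathcal E(P_i)\in\{\pm1\}^\tau$ be given by $P_iP_j=\mathcal E(P_i)_jP_jP_i$ for $j\le i$ and $\mathcal E(P_i)_j=1$ for $j>i$. Let $\mathcal E$ be the group generated by $\mathcal E(P_1),\dots,\mathcal E(P_\tau)$ under componentwise multiplication,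 $\mathcal E^{(P_A)}=\{e\cdot\mathcal C(P_A):e\in\mathcal E\}$, and $\mathcal E_{\rm total}=\bigcup_{P_A}\mathcal E^{(P_A)}$. The code is *recoverable* if $e\cdot\mathcal C(P_A)\ne f\cdot\mathcal C(Q_A)$ for all $e,f\in\mathcal E$ and all $P_A\ne Q_A$ in $\mathrm{Pauli}_A$. Fix a decoder, that is, a map $D:\{\pm1\}^\tau\to\mathrm{Pauli}_A$ such that $s\in\mathcal E^{(D(s))}$ for every $s\in\mathcal E_{\rm total}$ (the values of $D$ outside $\mathcal E_{\rm total}$ are arbitrary). **Distillation algorithm.** The circuit is run on the maximally mixed state of $AB$, purified by a reference $R$; let $|\Psi(m)\rangle_{ABR}$ be its normalised output for outcomes $m$. Keep $A$ aside and add $n_A$ EPR pairs $|\mathrm{EPR}\rangle$ on $A'\overline A$. Measure $P_\tau,\dots,P_1$, in this order, on $A'B$ (with $A'$ in the place of $A$), with outcomes $\overline m$, i.e. apply $\Pi(\overline m)^\dagger$ and normalise. Compute $s=m\cdot\overline m$ and apply $D(s)$ to $\overline A$. Let $\mathrm{Prob}(m,\overline m)$ be the joint probability of $m$ and $\overline m$,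 let $\sigma_{A\overline A}(m,\overline m)$ be the resulting reduced state of $A\overline A$, and let $$\mathbb E(\sigma_{A\overline A})=\sum_{m,\overline m}\mathrm{Prob}(m,\overline m)\,\sigma_{A\overline A}(m,\overline m).$$ **Lemma.** For every monitored Clifford circuit and every decoder $D$, $$\mathbb E(\sigma_{A\overline A})=\frac{1}{N_{I_A}}\sum_{P_A:\ \mathcal C(P_A)\in\mathcal E}|P_A\rangle\langle P_A|,$$ where $|P_A\rangle=(P_A\otimes I_{\overline A})|\mathrm{EPR}\rangle_{A\overline A}$ is the Choi state of $P_A$ and $N_{I_A}$ is the number of $P_A\in\mathrm{Pauli}_A$ with $\mathcal C(P_A)\in\mathcal E$. Hence perfect EPR pairs are distilled exactly when the classical code is recoverable: $\mathbb E(\sigma_{A\overline A})=|\mathrm{EPR}\rangle\langle\mathrm{EPR}|$ if and only if the code is recoverable, and $\sigma_{A\overline A}(m,\overline m)=|\mathrm{EPR}\rangle\langle\mathrm{EPR}|$ for all outcomes with $\mathrm{Prob}(m,\overline m)\neq0$ if and only if the code is recoverable. -/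

import Mathlib

open scoped Kronecker BigOperators ComplexConjugate

noncomputable section

/-- The four single-qubit Pauli operators. -/
inductive PauliLabel where
  | I | X | Y | Z
deriving DecidableEq

namespace PauliLabel

instance : Fintype PauliLabel :=
  ⟨{I, X, Y, Z}, fun p => by cases p <;> decide⟩

/-- The `2 × 2` matrix of a single-qubit Pauli operator. -/
def toMatrix : PauliLabel → Matrix (Fin 2) (Fin 2) ℂ
  | I => !![1, 0; 0, 1]
  | X => !![0, 1; 1, 0]
  | Y => !![0, -Complex.I; Complex.I, 0]
  | Z => !![1, 0; 0, -1]

end PauliLabel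

namespace Monitored

/-- Labels of the computational basis of a set `S` of qubits. -/
abbrev Qubits (S : Type*) := S → Fin 2

/-- A Pauli string on the qubits `S`; there are `4 ^ |S|` of them. They are the Pauli operators on
`S`, with phases disregarded. -/
abbrev PauliString (S : Type*) := S → PauliLabel

/-- The operator of a Pauli string, the tensor product of its single-qubit factors. -/
def pauliOp {S : Type*} [Fintype S] (p : PauliString S) :
    Matrix (Qubits S) (Qubits S) ℂ :=
  fun x y => ∏ i, (p i).toMatrix (x i) (y i)

/-- Operators on the bipartite system `AB`. -/
abbrev Op (A B : Type*) := Matrix (Qubits A × Qubits B) (Qubits A × Qubits B) ℂ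

/-- Sequences of `τ` signs, under componentwise multiplication. -/
abbrev SignVec (τ : ℕ) := Fin τ → ℤˣ

/-- A sign as a complex number. -/
def signC (e : ℤˣ) : ℂ := ((e : ℤ) : ℂ)

section Kets

/-- Squared norm of a ket given by its amplitudes. -/
def normSq {ι : Type*} [Fintype ι] (ψ : ι → ℂ) : ℝ := ∑ i, ‖ψ i‖ ^ 2

/-- The normalised ket `ψ / ‖ψ‖` (the zero ket if `ψ = 0`). -/
def normalize {ι : Type*} [Fintype ι] (ψ : ι → ℂ) : ι → ℂ :=
  fun i => ((Real.sqrt (normSq ψ) : ℝ) : ℂ)⁻¹ * ψ i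

/-- The maximally entangled ket `d ^ (-1/2) ∑ x, |x⟩|x⟩`, `d` being the dimension. -/
def epr (ι : Type*) [Fintype ι] [DecidableEq ι] : ι × ι → ℂ :=
  fun x => if x.1 = x.2 then ((Real.sqrt (Fintype.card ι) : ℝ) : ℂ)⁻¹ else 0

/-- The rank-one operator `|ψ⟩⟨ψ|`. -/
def ketBra {ι : Type*} (ψ : ι → ℂ) : Matrix ι ι ℂ :=
  Matrix.of fun i j => ψ i * conj (ψ j)

end Kets

variable {A B : Type*} [Fintype A] [DecidableEq A] [Fintype B] [DecidableEq B]

/-- The operator of the Pauli string `p ⊗ q` on `AB`. -/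
def pauliOpAB (p : PauliString A) (q : PauliString B) : Op A B :=
  pauliOp p ⊗ₖ pauliOp q

/-- A Clifford unitary on `AB`: conjugation by it maps every Pauli operator to a Pauli operator
(up to a sign). -/
def IsClifford (U : Op A B) : Prop :=
  U ∈ Matrix.unitaryGroup (Qubits A × Qubits B) ℂ ∧
    ∀ (p : PauliString A) (q : PauliString B),
      ∃ (e : ℤˣ) (p' : PauliString A) (q' : PauliString B),
        U * pauliOpAB p q * U.conjTranspose = signC e • pauliOpAB p' q'

variable (A B) in
/-- A monitored Clifford circuit with `τ` layers on `AB`. Layer `j` is the projective measurement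
of the signed Pauli operator `sign j • (pauliA j ⊗ pauliB j)`, followed by the Clifford
unitary `U j`. -/
structure Circuit (τ : ℕ) where
  sign : Fin τ → ℤˣ
  pauliA : Fin τ → PauliString A
  pauliB : Fin τ → PauliString B
  U : Fin τ → Op A B
  clifford : ∀ j, IsClifford (U j)

/-- The projector `(I + mP)/2` on the eigenspace of `P` with eigenvalue `m = ±1`. -/
def proj (P : Op A B) (m : ℤˣ) : Op A B := (1 / 2 : ℂ) • (1 + signC m • P)

/-- `+1` if the two operators commute and `-1` otherwise. Pauli operators that do not commute
anticommute. -/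
def commSign (P Q : Op A B) : ℤˣ :=
  open Classical in if P * Q = Q * P then 1 else -1

namespace Circuit

variable {τ : ℕ} (c : Circuit A B τ)

/-- The Pauli operator measured in layer `j` of the circuit. -/
def localPauli (j : Fin τ) : Op A B :=
  signC (c.sign j) • pauliOpAB (c.pauliA j) (c.pauliB j)

/-- The unitary `U_τ ⋯ U_j`. -/
def evolution (j : Fin τ) : Op A B :=
  ((List.ofFn c.U).drop j.val).reverse.prod

/-- The time-evolved measured operator `P_j = (U_τ ⋯ U_j) P'_j (U_τ ⋯ U_j)†`. -/
def pauli (j : Fin τ) : Op A B :=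
  c.evolution j * c.localPauli j * (c.evolution j).conjTranspose

/-- The operation `U_τ Π'_τ(m_τ) ⋯ U_1 Π'_1(m_1)` that the circuit implements on outcomes `m`. -/
def kraus (m : SignVec τ) : Op A B :=
  (List.ofFn fun j => c.U j * proj (c.localPauli j) (m j)).reverse.prod

/-- The operation `Π(m) = Π_τ(m_τ) ⋯ Π_1(m_1)` of sequential measurement of `P_1, …, P_τ`. -/
def seqProj (m : SignVec τ) : Op A B :=
  (List.ofFn fun j => proj (c.pauli j) (m j)).reverse.prod

/-! ### The dual classical code -/

/-- The codeword vector of a Pauli operator supported on `A`. -/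
def codeword (p : PauliString A) : SignVec τ :=
  fun j => commSign (pauliOpAB p (fun _ => PauliLabel.I)) (c.pauli j)

/-- The error vector of `P_i`; it sees only the operators measured before it. -/
def errorVec (i : Fin τ) : SignVec τ :=
  fun j => if j ≤ i then commSign (c.pauli i) (c.pauli j) else 1

/-- The group generated by the error vectors. -/
def errorGroup : Subgroup (SignVec τ) := Subgroup.closure (Set.range c.errorVec)

/-- All vectors into which the codeword of `p` may be turned by errors. -/
def coset (p : PauliString A) : Set (SignVec τ) :=
  {s | ∃ e ∈ c.errorGroup, s = e * c.codeword p}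

/-- The union of the cosets of all codewords. -/
def total : Set (SignVec τ) := ⋃ p, c.coset p

/-- The initial information in the classical code is fully recoverable: no errors can turn the
codewords of two distinct Pauli operators into the same vector. -/
def Recoverable : Prop :=
  ∀ p q : PauliString A, p ≠ q → ∀ e ∈ c.errorGroup, ∀ f ∈ c.errorGroup,
    e * c.codeword p ≠ f * c.codeword q

/-- The Pauli operators on `A` that are indistinguishable from the identity. -/
def nullPaulis : Finset (PauliString A) :=
  open Classical in Finset.univ.filter fun p => c.codeword p ∈ c.errorGroup

/-- `D` decodes: whenever `s` comes from some codeword by an error, then it comes from the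
codeword of `D s` by an error. -/
def IsDecoder (D : SignVec τ → PauliString A) : Prop :=
  ∀ s ∈ c.total, s ∈ c.coset (D s)

/-! ### The distillation algorithm -/

/-- The unnormalised state of `AB` and its reference `R` after the circuit with outcomes `m`, run
on a maximally mixed state purified by `R`. -/
def forwardKet (m : SignVec τ) :
    (Qubits A × Qubits B) × (Qubits A × Qubits B) → ℂ :=
  (c.kraus m ⊗ₖ (1 : Op A B)).mulVec (epr (Qubits A × Qubits B))

/-- The probability of the outcomes `m` of the circuit. -/
def probForward (m : SignVec τ) : ℝ := normSq (c.forwardKet m)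

/-- The output state `|Ψ(m)⟩` of the circuit, on `AB` and `R`. -/
def output (m : SignVec τ) : (Qubits A × Qubits B) × (Qubits A × Qubits B) → ℂ :=
  normalize (c.forwardKet m)

end Circuit

variable (A B) in
/-- Basis labels of all the registers of the algorithm. `A` holds the qubits which are kept aside,
`B` the rest of the circuit's output and `R` the reference. `A'` and `Abar` hold the two halves of
the fresh EPR pairs; `A'` takes the place of `A` in the reverse circuit. -/
structure Registers where
  a : Qubits A
  b : Qubits B
  r : Qubits A × Qubits B
  a' : Qubits A
  abar : Qubits A

variable (A B) in
/-- The registers as a product. -/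
def Registers.equivProd : Registers A B ≃
    Qubits A × Qubits B × (Qubits A × Qubits B) × Qubits A × Qubits A where
  toFun x := (x.a, x.b, x.r, x.a', x.abar)
  invFun x := ⟨x.1, x.2.1, x.2.2.1, x.2.2.2.1, x.2.2.2.2⟩
  left_inv _ := rfl
  right_inv _ := rfl

instance : Fintype (Registers A B) := Fintype.ofEquiv _ (Registers.equivProd A B).symm

namespace Circuit

variable {τ : ℕ} (c : Circuit A B τ)

/-- `|Ψ(m)⟩` together with fresh EPR pairs. -/
def withAncilla (m : SignVec τ) : Registers A B → ℂ :=
  fun x => c.output m ((x.a, x.b), x.r) * epr (Qubits A) (x.a', x.abar)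

/-- The unnormalised state after `P_τ, …, P_1` have been measured, in this order, on `A'B` with
outcomes `mbar`, that is, after `Π(mbar)†` has been applied to `A'B`. -/
def reverseKet (m mbar : SignVec τ) : Registers A B → ℂ :=
  fun x => ∑ y : Qubits A × Qubits B,
    (c.seqProj mbar).conjTranspose (x.a', x.b) y *
      c.withAncilla m { x with a' := y.1, b := y.2 }

/-- The joint probability of `m` and `mbar`: that of `m` times that of `mbar` given `m`. -/
def prob (m mbar : SignVec τ) : ℝ := c.probForward m * normSq (c.reverseKet m mbar)

/-- The normalised state after the reverse measurements and the feedback, which applies the Pauli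
operator that the decoder `D` finds for `m * mbar` to `Abar`. -/
def finalKet (D : SignVec τ → PauliString A) (m mbar : SignVec τ) : Registers A B → ℂ :=
  fun x => ∑ z : Qubits A,
    pauliOp (D (m * mbar)) x.abar z * normalize (c.reverseKet m mbar) { x with abar := z }

/-- The output of the algorithm for the outcomes `m`, `mbar`: the reduced density matrix of
`A Abar`, with `B`, `R` and `A'` traced out. -/
def sigma (D : SignVec τ → PauliString A) (m mbar : SignVec τ) :
    Matrix (Qubits A × Qubits A) (Qubits A × Qubits A) ℂ :=
  Matrix.of fun x y => ∑ b : Qubits B, ∑ r : Qubits A × Qubits B, ∑ a' : Qubits A,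
    c.finalKet D m mbar ⟨x.1, b, r, a', x.2⟩ * conj (c.finalKet D m mbar ⟨y.1, b, r, a', y.2⟩)

/-- The statistical average of the output over all outcomes. -/
def averageOutput (D : SignVec τ → PauliString A) :
    Matrix (Qubits A × Qubits A) (Qubits A × Qubits A) ℂ :=
  ∑ m : SignVec τ, ∑ mbar : SignVec τ, (c.prob m mbar : ℂ) • c.sigma D m mbar

end Circuit

/-- The Choi state `(P ⊗ I)|EPR⟩` on `A Abar` of a Pauli operator `P` on `A`. -/
def choi (p : PauliString A) : Qubits A × Qubits A → ℂ :=
  (pauliOp p ⊗ₖ (1 : Matrix (Qubits A) (Qubits A) ℂ)).mulVec (epr (Qubits A))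

end Monitored

end

/-! Weighting by the joint probability removes every normalisation, so the average is a sum of
unnormalised states. Tracing out `R` leaves `Π(m)Π(m)†`, in which the accumulated unitary cancels.
This operator is `2^{-τ} ∑_S χ_S(m) P^S` over the subsets `S` that pair trivially with every error
vector (`seqProj_expansion`): each new measurement kills the terms that anticommute with its
observable. Fix the syndrome `s = m * mbar` and sum over `m`: orthogonality of characters pairs each
`P^S` with itself (`sum_seqProj_mul`). Tracing out `B` then leaves a multiple of `P ⊗ Pᵀ`, with `P`
the `A`-part of `P^S`; it is diagonal in the Choi basis, and its eigenvalue at `q` is the pairing of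
`S` with the codeword of `q` (`sum_seqPow_mul`). Summing over `S`, duality (`sum_annihilator`)
keeps, all with one weight, the `q` whose codeword differs from `s` by an error
(`sum_sum_jointKet`). Feedback multiplies `q` by `D s`, which carries these `q` bijectively onto the
null Paulis (`sum_syndrome`). Every syndrome in `total` thus contributes the same uniform mixture,
and a double count fixes the weight.

For the equivalences, `codeword` is a homomorphism, so recoverability means that only the identity
is null (`recoverable_iff`). Choi states are orthonormal (`overlap_choi`), so the uniform mixture is
the EPR state only in that case. Since a pure state is a mixture only of itself
(`sum_ketBra_eq_of_mixture`), the statement on the average passes to each outcome. -/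

/-! ### Single-qubit Pauli algebra. -/

namespace PauliLabel

/-- The product of two Pauli operators, phases disregarded. -/
def mul : PauliLabel → PauliLabel → PauliLabel
  | I, q => q
  | p, I => p
  | X, X => I
  | Y, Y => I
  | Z, Z => I
  | X, Y => Z
  | Y, X => Z
  | Y, Z => X
  | Z, Y => X
  | Z, X => Y
  | X, Z => Y

/-- Modulo phases the labels form the Klein four-group. Products of strings then need no order, and
commutation signs and codewords become homomorphisms. -/
instance : CommGroup PauliLabel where
  mul := mul
  one := I
  inv p := p
  mul_assoc := by decide
  one_mul := by decide
  mul_one := by decide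
  inv_mul_cancel := by decide
  mul_comm := by decide

lemma mul_self (p : PauliLabel) : p * p = 1 := by revert p; decide

/-- The sign by which two Pauli operators commute. -/
def comm (p q : PauliLabel) : ℤˣ := if p = I ∨ q = I ∨ p = q then 1 else -1

lemma comm_mul_left : ∀ p p' q : PauliLabel, comm (p * p') q = comm p q * comm p' q := by decide

lemma comm_comm : ∀ p q : PauliLabel, comm p q = comm q p := by decide

lemma toMatrix_one : toMatrix 1 = 1 := by
  change toMatrix I = 1
  simp [toMatrix, Matrix.one_fin_two]

/-- Only the modulus of the phase is recorded; rank-one operators see nothing else. -/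
lemma exists_toMatrix_mul (p q : PauliLabel) :
    ∃ z : ℂ, ‖z‖ = 1 ∧ p.toMatrix * q.toMatrix = z • (p * q).toMatrix := by
  cases p <;> cases q
  case X.Y => exact ⟨Complex.I, by simp, by change _ = _ • toMatrix Z; simp [toMatrix]⟩
  case Y.X => exact ⟨-Complex.I, by simp, by change _ = _ • toMatrix Z; simp [toMatrix]⟩
  case Y.Z => exact ⟨Complex.I, by simp, by change _ = _ • toMatrix X; simp [toMatrix]⟩
  case Z.Y => exact ⟨-Complex.I, by simp, by change _ = _ • toMatrix X; simp [toMatrix]⟩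
  case Z.X => exact ⟨Complex.I, by simp, by change _ = _ • toMatrix Y; simp [toMatrix]⟩
  case X.Z => exact ⟨-Complex.I, by simp, by change _ = _ • toMatrix Y; simp [toMatrix]⟩
  case X.X => exact ⟨1, by simp, by change _ = _ • toMatrix I; simp [toMatrix]⟩
  case Y.Y => exact ⟨1, by simp, by change _ = _ • toMatrix I; simp [toMatrix]⟩
  case Z.Z => exact ⟨1, by simp, by change _ = _ • toMatrix I; simp [toMatrix]⟩
  case I.I => exact ⟨1, by simp, by change _ = _ • toMatrix I; simp [toMatrix]⟩
  case I.X => exact ⟨1, by simp, by change _ = _ • toMatrix X; simp [toMatrix]⟩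
  case I.Y => exact ⟨1, by simp, by change _ = _ • toMatrix Y; simp [toMatrix]⟩
  case I.Z => exact ⟨1, by simp, by change _ = _ • toMatrix Z; simp [toMatrix]⟩
  case X.I => exact ⟨1, by simp, by change _ = _ • toMatrix X; simp [toMatrix]⟩
  case Y.I => exact ⟨1, by simp, by change _ = _ • toMatrix Y; simp [toMatrix]⟩
  case Z.I => exact ⟨1, by simp, by change _ = _ • toMatrix Z; simp [toMatrix]⟩

lemma toMatrix_mul_self (p : PauliLabel) : p.toMatrix * p.toMatrix = 1 := by
  cases p <;> simp [toMatrix, Matrix.one_fin_two]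

lemma toMatrix_mul_comm (p q : PauliLabel) :
    p.toMatrix * q.toMatrix = Monitored.signC (comm p q) • (q.toMatrix * p.toMatrix) := by
  cases p <;> cases q <;> simp [toMatrix, comm, Monitored.signC]

lemma conj_toMatrix (p : PauliLabel) (x y : Fin 2) :
    conj (p.toMatrix x y) = p.toMatrix y x := by
  fin_cases x <;> fin_cases y <;> cases p <;> simp [toMatrix]

lemma exists_toMatrix_transpose (p : PauliLabel) :
    ∃ z : ℂ, ‖z‖ = 1 ∧ ∀ x y, p.toMatrix x y = z * p.toMatrix y x := by
  cases p
  case Y =>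
    refine ⟨-1, by simp, fun x y => ?_⟩
    fin_cases x <;> fin_cases y <;> simp [toMatrix]
  all_goals
    refine ⟨1, by simp, fun x y => ?_⟩
    fin_cases x <;> fin_cases y <;> simp [toMatrix]

lemma sum_eq (f : PauliLabel → ℂ) : ∑ p, f p = f I + f X + f Y + f Z := by
  change ∑ p ∈ ({I, X, Y, Z} : Finset PauliLabel), f p = _
  simp [Finset.sum_insert, add_assoc]

/-- The Pauli operators resolve `P ⊗ Pᵀ` in the Bell basis. -/
lemma sum_comm_mul (p : PauliLabel) (x y x' y' : Fin 2) :
    ∑ q, Monitored.signC (comm p q) * (q.toMatrix x y * conj (q.toMatrix x' y')) =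
      2 * (p.toMatrix x x' * p.toMatrix y' y) := by
  rw [sum_eq]
  cases p <;> fin_cases x <;> fin_cases y <;> fin_cases x' <;> fin_cases y' <;>
    simp [toMatrix, comm, Monitored.signC] <;> norm_num

lemma sum_toMatrix_diag {p : PauliLabel} (hp : p ≠ 1) : ∑ x, p.toMatrix x x = 0 := by
  cases p
  · exact absurd rfl hp
  all_goals simp [toMatrix]

end PauliLabel

/-! ### Pauli strings. -/

namespace Monitored

section Pauli

variable {S : Type*} [Fintype S]

lemma PauliString.mul_self {S : Type*} (p : PauliString S) : p * p = 1 :=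
  funext fun i => (p i).mul_self

/-- The sign by which two Pauli strings commute. -/
def comm (p q : PauliString S) : ℤˣ := ∏ i, (p i).comm (q i)

lemma comm_mul_left (p p' q : PauliString S) : comm (p * p') q = comm p q * comm p' q := by
  simp [comm, PauliLabel.comm_mul_left, Finset.prod_mul_distrib]

lemma comm_comm (p q : PauliString S) : comm p q = comm q p :=
  Finset.prod_congr rfl fun _ _ => PauliLabel.comm_comm _ _

lemma comm_one_left (q : PauliString S) : comm 1 q = 1 := by
  simpa using comm_mul_left 1 1 q

lemma signC_mul (e f : ℤˣ) : signC (e * f) = signC e * signC f := by simp [signC]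

lemma signC_one : signC 1 = 1 := by simp [signC]

lemma signC_neg (e : ℤˣ) : signC (-e) = -signC e := by simp [signC]

lemma signC_mul_self (e : ℤˣ) : signC e * signC e = 1 := by
  rw [← signC_mul, ← sq, Int.units_sq, signC_one]

lemma norm_signC (e : ℤˣ) : ‖signC e‖ = 1 := by
  rcases Int.units_eq_one_or e with rfl | rfl <;> simp [signC]

lemma conj_signC (e : ℤˣ) : conj (signC e) = signC e := by
  simp [signC]

lemma signC_prod {ι : Type*} (s : Finset ι) (f : ι → ℤˣ) :
    signC (∏ i ∈ s, f i) = ∏ i ∈ s, signC (f i) := by simp [signC, Units.coe_prod]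

lemma pauliOp_one : pauliOp (1 : PauliString S) = 1 := by
  ext x y
  simp only [pauliOp, Pi.one_apply, PauliLabel.toMatrix_one, Matrix.one_apply, funext_iff]
  rw [Finset.prod_ite_zero]
  simp

lemma conj_pauliOp (p : PauliString S) (x y : Qubits S) :
    conj (pauliOp p x y) = pauliOp p y x := by
  simp [pauliOp, map_prod, PauliLabel.conj_toMatrix]

lemma conjTranspose_pauliOp (p : PauliString S) : (pauliOp p).conjTranspose = pauliOp p := by
  ext x y
  exact conj_pauliOp p y x

lemma exists_pauliOp_transpose (p : PauliString S) :
    ∃ z : ℂ, ‖z‖ = 1 ∧ ∀ x y, pauliOp p x y = z * pauliOp p y x := by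
  choose z hz h using fun i => PauliLabel.exists_toMatrix_transpose (p i)
  refine ⟨∏ i, z i, by simp [hz], fun x y => ?_⟩
  rw [pauliOp, pauliOp, ← Finset.prod_mul_distrib]
  exact Finset.prod_congr rfl fun i _ => h i _ _

variable [DecidableEq S]

lemma pauliOp_mul_apply (p q : PauliString S) (x y : Qubits S) :
    (pauliOp p * pauliOp q) x y = ∏ i, ((p i).toMatrix * (q i).toMatrix) (x i) (y i) := by
  simp only [Matrix.mul_apply, pauliOp, Fintype.prod_sum, Finset.prod_mul_distrib]

lemma exists_pauliOp_mul (p q : PauliString S) :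
    ∃ z : ℂ, ‖z‖ = 1 ∧ pauliOp p * pauliOp q = z • pauliOp (p * q) := by
  choose z hz h using fun i => PauliLabel.exists_toMatrix_mul (p i) (q i)
  refine ⟨∏ i, z i, by simp [hz], ?_⟩
  ext x y
  rw [pauliOp_mul_apply]
  simp [h, pauliOp, Finset.prod_mul_distrib]

lemma pauliOp_mul_self (p : PauliString S) : pauliOp p * pauliOp p = 1 := by
  rw [← pauliOp_one]
  ext x y
  rw [pauliOp_mul_apply]
  simp only [PauliLabel.toMatrix_mul_self, pauliOp, Pi.one_apply, PauliLabel.toMatrix_one]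

lemma pauliOp_mul_comm (p q : PauliString S) :
    pauliOp p * pauliOp q = signC (comm p q) • (pauliOp q * pauliOp p) := by
  ext x y
  rw [Matrix.smul_apply, pauliOp_mul_apply, pauliOp_mul_apply, comm, signC_prod, smul_eq_mul,
    ← Finset.prod_mul_distrib]
  exact Finset.prod_congr rfl fun i _ => by rw [PauliLabel.toMatrix_mul_comm]; rfl

/-- `P ⊗ Pᵀ` sends the Choi state of `q` to that of `PqP`, which is `q` up to the sign `comm p q`.
This is its spectral decomposition, obtained qubit by qubit. -/
lemma sum_comm_mul (p : PauliString S) (x y x' y' : Qubits S) :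
    ∑ q, signC (comm p q) * (pauliOp q x y * conj (pauliOp q x' y')) =
      2 ^ Fintype.card S * (pauliOp p x x' * pauliOp p y' y) := by
  simp only [pauliOp, map_prod, comm, signC_prod, ← Finset.prod_mul_distrib]
  rw [← Fintype.prod_sum fun i q => signC ((p i).comm q) *
    (q.toMatrix (x i) (y i) * conj (q.toMatrix (x' i) (y' i)))]
  simp [PauliLabel.sum_comm_mul, Finset.prod_mul_distrib]

lemma sum_pauliOp_diag {p : PauliString S} (hp : p ≠ 1) : ∑ x, pauliOp p x x = 0 := by
  obtain ⟨i, hi⟩ := Function.ne_iff.mp hp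
  simp only [pauliOp]
  rw [← Fintype.prod_sum fun i x => (p i).toMatrix x x]
  exact Finset.prod_eq_zero (Finset.mem_univ i) (PauliLabel.sum_toMatrix_diag hi)

end Pauli
end Monitored

/-! ### Pairing of subsets with sign vectors. -/

namespace Monitored

section Parity

lemma zmod_two_eq_zero_or_one : ∀ t : ZMod 2, t = 0 ∨ t = 1 := by decide

lemma pow_val_add {M : Type*} [Monoid M] {x : M} (hx : x * x = 1) (s t : ZMod 2) :
    x ^ (s + t).val = x ^ s.val * x ^ t.val := by
  rcases zmod_two_eq_zero_or_one s with rfl | rfl <;>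
    rcases zmod_two_eq_zero_or_one t with rfl | rfl
  · simp
  · simp
  · simp
  · rw [show (1 + 1 : ZMod 2) = 0 from rfl]
    simp [ZMod.val_one, hx]

lemma sum_zmod_two {M : Type*} [AddCommMonoid M] (f : ZMod 2 → M) : ∑ t, f t = f 0 + f 1 :=
  Fin.sum_univ_two f

/-- The pairing of a subset of `Fin n`, given by its indicator `S`, with a sign vector. -/
def chi {n : ℕ} (S : Fin n → ZMod 2) (m : SignVec n) : ℤˣ := ∏ j, m j ^ (S j).val

variable {n : ℕ}

lemma chi_mul (S : Fin n → ZMod 2) (m m' : SignVec n) : chi S (m * m') = chi S m * chi S m' := by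
  simp [chi, mul_pow, Finset.prod_mul_distrib]

lemma chi_one (S : Fin n → ZMod 2) : chi S 1 = 1 := by simp [chi]

lemma chi_zero (m : SignVec n) : chi 0 m = 1 := by simp [chi]

lemma chi_add (S T : Fin n → ZMod 2) (m : SignVec n) : chi (S + T) m = chi S m * chi T m := by
  simp only [chi, Pi.add_apply, ← Finset.prod_mul_distrib]
  exact Finset.prod_congr rfl fun j _ => pow_val_add (by rw [← sq, Int.units_sq]) _ _

lemma chi_snoc (S : Fin n → ZMod 2) (t : ZMod 2) (m : SignVec (n + 1)) :
    chi (Fin.snoc (α := fun _ => ZMod 2) S t) m =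
      chi S (fun j => m j.castSucc) * m (Fin.last n) ^ t.val := by
  simp [chi, Fin.prod_univ_castSucc]

lemma chi_mulSingle (S : Fin n → ZMod 2) (j : Fin n) (e : ℤˣ) :
    chi S (Pi.mulSingle j e) = e ^ (S j).val := by
  rw [chi, Finset.prod_eq_single j]
  · simp
  · intro i _ hi
    simp [Pi.mulSingle_eq_of_ne hi]
  · simp

end Parity

/-! ### Expansion of sequential measurements. -/

section Expansion

lemma conjTranspose_proj {A B : Type*} [Fintype A] [Fintype B] {Q : Op A B}
    (hQ : Q.conjTranspose = Q) (m : ℤˣ) :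
    (proj Q m).conjTranspose = proj Q m := by
  simp [proj, Matrix.conjTranspose_smul, hQ, signC]

variable {A B : Type*} [Fintype A] [DecidableEq A] [Fintype B] [DecidableEq B]

/-- The product of the operators `P j` with `S j = 1`, later ones on the left. -/
def seqPow {n : ℕ} (P : Fin n → Op A B) (S : Fin n → ZMod 2) : Op A B :=
  (List.ofFn fun j => P j ^ (S j).val).reverse.prod

lemma reverse_prod_ofFn_castSucc {M : Type*} [Monoid M] {n : ℕ} (f : Fin (n + 1) → M) :
    (List.ofFn f).reverse.prod =
      f (Fin.last n) * (List.ofFn fun j : Fin n => f j.castSucc).reverse.prod := by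
  rw [List.ofFn_succ', List.concat_eq_append]
  simp

lemma reverse_prod_ofFn_succ {M : Type*} [Monoid M] {n : ℕ} (f : Fin (n + 1) → M) :
    (List.ofFn f).reverse.prod = (List.ofFn fun j : Fin n => f j.succ).reverse.prod * f 0 := by
  simp [List.ofFn_succ]

lemma seqPow_snoc {n : ℕ} (P : Fin (n + 1) → Op A B) (S : Fin n → ZMod 2) (t : ZMod 2) :
    seqPow P (Fin.snoc (α := fun _ => ZMod 2) S t) =
      P (Fin.last n) ^ t.val * seqPow (fun j => P j.castSucc) S := by
  rw [seqPow, reverse_prod_ofFn_castSucc]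
  simp [seqPow]

lemma mul_pow_val_of_comm {P Q : Op A B} {ε : ℤˣ} (h : Q * P = signC ε • (P * Q)) (t : ZMod 2) :
    Q * P ^ t.val = signC (ε ^ t.val) • (P ^ t.val * Q) := by
  rcases zmod_two_eq_zero_or_one t with rfl | rfl
  · simp [signC]
  · simpa [ZMod.val_one] using h

lemma mul_seqPow_of_comm {n : ℕ} {P : Fin n → Op A B} {Q : Op A B} {ε : SignVec n}
    (h : ∀ i, Q * P i = signC (ε i) • (P i * Q)) (S : Fin n → ZMod 2) :
    Q * seqPow P S = signC (chi S ε) • (seqPow P S * Q) := by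
  induction n with
  | zero => simp [seqPow, chi, signC]
  | succ n ih =>
    induction S using Fin.snocCases with
    | _ S t =>
      rw [seqPow_snoc, chi_snoc, ← mul_assoc, mul_pow_val_of_comm (h _), smul_mul_assoc, mul_assoc,
        ih fun i => h i.castSucc, mul_smul_comm, smul_smul, signC_mul, mul_comm (signC _),
        mul_assoc]

/-- If `X` commutes with `Q`, the two projectors merge into one. If it anticommutes, it maps each
eigenspace of `Q` into the other, and its compression vanishes. -/
lemma proj_mul_proj {Q X : Op A B} {ε : ℤˣ} (hQ : Q * Q = 1) (h : Q * X = signC ε • (X * Q))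
    (m : ℤˣ) :
    proj Q m * X * proj Q m =
      if ε = 1 then (1 / 2 : ℂ) • ∑ t : ZMod 2, signC (m ^ t.val) • (Q ^ t.val * X) else 0 := by
  have hm := signC_mul_self m
  have hXQQ : X * Q * Q = X := by rw [mul_assoc, hQ, mul_one]
  have e1 : proj Q m * X * proj Q m = (1 / 4 : ℂ) •
      (X + signC m • (X * Q) + signC m • (Q * X) + Q * X * Q) := by
    simp only [proj, smul_mul_assoc, mul_smul_comm, add_mul, mul_add, one_mul, mul_one, smul_add,
      smul_smul]
    linear_combination (norm := module) ((1 / 4 : ℂ) * hm) • (Q * X * Q)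
  rcases Int.units_eq_one_or ε with rfl | rfl
  · rw [e1, h, if_pos rfl, sum_zmod_two]
    simp only [signC_one, one_smul, hXQQ, ZMod.val_zero, pow_zero, one_mul, ZMod.val_one, pow_one, h]
    module
  · rw [e1, h, if_neg (by decide)]
    simp only [signC_neg, signC_one, neg_smul, one_smul, neg_mul, hXQQ]
    module

open Classical in
/-- A sequence of measurements of pairwise commuting or anticommuting observables, expanded in
their products. The vector `E j` holds the signs by which `P j` commutes with its predecessors. -/
lemma seqProj_expansion {n : ℕ} (P : Fin n → Op A B) (E : Fin n → SignVec n)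
    (hH : ∀ j, (P j).conjTranspose = P j) (hsq : ∀ j, P j * P j = 1)
    (hcomm : ∀ j i, i < j → P j * P i = signC (E j i) • (P i * P j))
    (hE : ∀ j i, j ≤ i → E j i = 1) (m : SignVec n) :
    (List.ofFn fun j => proj (P j) (m j)).reverse.prod *
        (List.ofFn fun j => proj (P j) (m j)).reverse.prod.conjTranspose =
      (1 / 2 : ℂ) ^ n • ∑ S : Fin n → ZMod 2,
        if ∀ j, chi S (E j) = 1 then signC (chi S m) • seqPow P S else 0 := by
  induction n with
  | zero => simp [chi, seqPow, signC]
  | succ n ih =>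
    have := ih (fun j => P j.castSucc) (fun j i => E j.castSucc i.castSucc) (fun j => hH _)
      (fun j => hsq _) (fun j i h => hcomm _ _ (by simpa using h))
      (fun j i h => hE _ _ (by simpa using h)) fun j => m j.castSucc
    rw [reverse_prod_ofFn_castSucc, Matrix.conjTranspose_mul, conjTranspose_proj (hH _),
      ← mul_assoc, mul_assoc (proj _ _), this, mul_smul_comm, smul_mul_assoc, pow_succ, mul_smul,
      Finset.mul_sum, Finset.sum_mul, ← Equiv.sum_comp (Fin.snocEquiv fun _ => ZMod 2),
      Fintype.sum_prod_type, Finset.sum_comm, Finset.smul_sum (r := (1 / 2 : ℂ))]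
    congr 1
    refine Finset.sum_congr rfl fun S _ => ?_
    -- Every `E j` is `1` at the last coordinate, so the condition does not involve `t`. It asks
    -- that `S` survive the earlier measurements and that its product commute with the last
    -- observable.
    have hv (t : ZMod 2) : (∀ j, chi (Fin.snocEquiv (fun _ => ZMod 2) (t, S)) (E j) = 1) ↔
        (∀ j : Fin n, chi S (fun i => E j.castSucc i.castSucc) = 1) ∧
          chi S (fun i => E (Fin.last n) i.castSucc) = 1 := by
      simp only [Fin.snocEquiv, Equiv.coe_fn_mk, chi_snoc, Fin.forall_fin_succ',
        hE _ _ (Fin.le_last _), one_pow, mul_one]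
    simp only [hv]
    by_cases h1 : ∀ j : Fin n, chi S (fun i => E j.castSucc i.castSucc) = 1
    · rw [if_pos h1, mul_smul_comm, smul_mul_assoc,
        proj_mul_proj (hsq _) (mul_seqPow_of_comm (fun i => hcomm _ _ (Fin.castSucc_lt_last i)) S)]
      by_cases h2 : chi S (fun i => E (Fin.last n) i.castSucc) = 1
      · simp only [h1, h2, implies_true, and_self, if_true, Fin.snocEquiv, Equiv.coe_fn_mk,
          chi_snoc, seqPow_snoc, signC_mul, mul_smul, Finset.smul_sum]
        exact Finset.sum_congr rfl fun t _ => smul_comm _ _ _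
      · simp [h2]
    · rw [if_neg h1]
      simp [h1]

end Expansion
end Monitored

/-! ### Character duality for sign vectors. -/

namespace Monitored

section Duality

variable {n : ℕ}

/-- Every character of the sign vectors is a pairing. -/
lemma exists_chi_eq (φ : SignVec n →* ℂˣ) :
    ∃ S : Fin n → ZMod 2, ∀ m, φ m = Units.map (Int.castRingHom ℂ).toMonoidHom (chi S m) := by
  have hsq (m : SignVec n) : φ m = 1 ∨ φ m = -1 := by
    have h : φ m * φ m = 1 := by
      rw [← map_mul, show m * m = 1 from funext fun j => by simp [← sq], map_one]
    rcases mul_self_eq_one_iff.mp (by simpa [Units.ext_iff] using h : (φ m : ℂ) * φ m = 1) with h | h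
    · exact Or.inl (Units.ext h)
    · exact Or.inr (Units.ext (by simpa using h))
  classical
  -- The vectors with a single `-1` generate the group, so `S` need only mark those that `φ` sends
  -- to `-1`.
  refine ⟨fun j => if φ (Pi.mulSingle j (-1)) = 1 then 0 else 1, fun m => ?_⟩
  conv_lhs => rw [← Finset.univ_prod_mulSingle m]
  rw [map_prod, chi, map_prod]
  refine Finset.prod_congr rfl fun j _ => ?_
  rcases Int.units_eq_one_or (m j) with h | h
  · simp [h]
  · rw [h]
    split_ifs with h1
    · simp [h1]
    · rw [(hsq _).resolve_left h1]
      ext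
      simp [ZMod.val_one]

/-- Characters of the finite abelian quotient by `H` separate the nontrivial class of `s` from the
identity. -/
lemma exists_chi_ne_one {H : Subgroup (SignVec n)} {s : SignVec n} (hs : s ∉ H) :
    ∃ S : Fin n → ZMod 2, (∀ h ∈ H, chi S h = 1) ∧ chi S s = -1 := by
  have hne : (QuotientGroup.mk s : SignVec n ⧸ H) ≠ 1 := by simpa using hs
  obtain ⟨φ, hφ⟩ :=
    CommGroup.exists_apply_ne_one_of_hasEnoughRootsOfUnity (SignVec n ⧸ H) ℂ hne
  obtain ⟨S, hS⟩ := exists_chi_eq (φ.comp (QuotientGroup.mk' H))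
  refine ⟨S, fun h hh => ?_, ?_⟩
  · have h1 := hS h
    rw [MonoidHom.comp_apply, QuotientGroup.mk'_apply, (QuotientGroup.eq_one_iff h).mpr hh,
      map_one] at h1
    rcases Int.units_eq_one_or (chi S h) with h2 | h2
    · exact h2
    · rw [h2] at h1
      have := congrArg Units.val h1
      norm_num at this
  · refine (Int.units_eq_one_or _).resolve_left fun h1 => hφ ?_
    have := hS s
    rw [h1, map_one] at this
    exact this

open Classical in
/-- The subsets that pair trivially with all of `H`. -/
noncomputable def annihilator (H : Subgroup (SignVec n)) : Finset (Fin n → ZMod 2) :=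
  Finset.univ.filter fun S => ∀ h ∈ H, chi S h = 1

lemma mem_annihilator {H : Subgroup (SignVec n)} {S : Fin n → ZMod 2} :
    S ∈ annihilator H ↔ ∀ h ∈ H, chi S h = 1 := by simp [annihilator]

lemma mem_annihilator_closure {ι : Type*} (E : ι → SignVec n) {S : Fin n → ZMod 2} :
    S ∈ annihilator (Subgroup.closure (Set.range E)) ↔ ∀ j, chi S (E j) = 1 := by
  rw [mem_annihilator]
  refine ⟨fun h j => h _ (Subgroup.subset_closure ⟨j, rfl⟩), fun h x hx => ?_⟩
  let f : SignVec n →* ℤˣ := ⟨⟨chi S, chi_one S⟩, chi_mul S⟩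
  have : Subgroup.closure (Set.range E) ≤ f.ker := by
    rw [Subgroup.closure_le]
    rintro _ ⟨j, rfl⟩
    exact h j
  exact this hx

open Classical in
-- Outside `H`, translation by an annihilating `T` with `chi T s = -1` permutes the terms and flips
-- their signs.
lemma sum_annihilator (H : Subgroup (SignVec n)) (s : SignVec n) :
    ∑ S ∈ annihilator H, signC (chi S s) = if s ∈ H then ((annihilator H).card : ℂ) else 0 := by
  split_ifs with hs
  · rw [Finset.sum_congr rfl fun S hS => by rw [mem_annihilator.mp hS s hs]]
    simp [signC]
  · obtain ⟨T, hT, hTs⟩ := exists_chi_ne_one hs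
    refine self_eq_neg.mp ?_
    rw [← Finset.sum_neg_distrib]
    refine Finset.sum_equiv (Equiv.addRight T) (fun S => ?_) fun S _ => ?_
    · simp only [mem_annihilator, Equiv.coe_addRight, chi_add]
      exact forall₂_congr fun h hh => by rw [hT h hh, mul_one]
    · simp [chi_add, hTs, signC]

lemma sum_signC_chi (S : Fin n → ZMod 2) :
    ∑ m : SignVec n, signC (chi S m) = if S = 0 then (2 : ℂ) ^ n else 0 := by
  split_ifs with hS
  · simp [hS, chi_zero, signC]
  · obtain ⟨j, hj⟩ := Function.ne_iff.mp hS
    have hj1 : S j = 1 := (zmod_two_eq_zero_or_one _).resolve_left hj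
    refine self_eq_neg.mp ?_
    rw [← Finset.sum_neg_distrib]
    refine Fintype.sum_equiv (Equiv.mulRight (Pi.mulSingle j (-1))) _ _ fun m => ?_
    simp [chi_mul, chi_mulSingle, hj1, ZMod.val_one, signC]

/-- The double sum of `chi S s` is evaluated in both orders; summed over `s` first, only `S = 0`
survives. -/
lemma card_annihilator_mul (H : Subgroup (SignVec n)) :
    ((annihilator H).card : ℂ) * (Nat.card H : ℂ) = 2 ^ n := by
  classical
  have h0 : (0 : Fin n → ZMod 2) ∈ annihilator H := mem_annihilator.mpr fun h _ => chi_zero h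
  calc ((annihilator H).card : ℂ) * (Nat.card H : ℂ)
      = ∑ s : SignVec n, ∑ S ∈ annihilator H, signC (chi S s) := by
        simp only [sum_annihilator, ← Finset.sum_filter, Finset.sum_const, nsmul_eq_mul]
        rw [Nat.card_eq_fintype_card, Fintype.card_subtype, mul_comm]
    _ = 2 ^ n := by
        rw [Finset.sum_comm]
        simp [sum_signC_chi, h0]

end Duality

/-! ### Clifford evolution of the measured observables. -/

section Clifford

variable {A B : Type*} [Fintype A] [DecidableEq A] [Fintype B] [DecidableEq B]

lemma IsClifford.mul {U V : Op A B} (hU : IsClifford U) (hV : IsClifford V) :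
    IsClifford (U * V) := by
  refine ⟨mul_mem hU.1 hV.1, fun p q => ?_⟩
  obtain ⟨e, p', q', h⟩ := hV.2 p q
  obtain ⟨f, p'', q'', h'⟩ := hU.2 p' q'
  refine ⟨e * f, p'', q'', ?_⟩
  rw [Matrix.conjTranspose_mul, signC_mul, mul_smul, ← h', ← smul_mul_assoc, ← mul_smul_comm, ← h]
  simp only [mul_assoc]

lemma isClifford_one : IsClifford (1 : Op A B) :=
  ⟨one_mem _, fun p q => ⟨1, p, q, by simp [signC]⟩⟩

lemma isClifford_list_prod {l : List (Op A B)} (h : ∀ U ∈ l, IsClifford U) :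
    IsClifford l.prod := by
  induction l with
  | nil => exact isClifford_one
  | cons U l ih =>
    rw [List.prod_cons]
    exact (h U (by simp)).mul (ih fun V hV => h V (by simp [hV]))

namespace Circuit

variable {τ : ℕ} (c : Circuit A B τ)

lemma isClifford_evolution (j : Fin τ) : IsClifford (c.evolution j) := by
  refine isClifford_list_prod fun U hU => ?_
  obtain ⟨i, rfl⟩ := (List.mem_ofFn' _ _).mp (List.mem_of_mem_drop (List.mem_reverse.mp hU))
  exact c.clifford i

/-- Beyond unitarity, this is all that the argument needs of the Clifford property. -/
lemma exists_pauli_eq (j : Fin τ) :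
    ∃ (e : ℤˣ) (g : PauliString A × PauliString B),
      c.pauli j = signC e • pauliOpAB g.1 g.2 := by
  obtain ⟨e, p, q, h⟩ := (c.isClifford_evolution j).2 (c.pauliA j) (c.pauliB j)
  exact ⟨c.sign j * e, (p, q), by
    rw [pauli, localPauli, mul_smul_comm, smul_mul_assoc, h, smul_smul, signC_mul]⟩

/-- The circuit without its first layer. -/
def tail (c : Circuit A B (τ + 1)) : Circuit A B τ where
  sign j := c.sign j.succ
  pauliA j := c.pauliA j.succ
  pauliB j := c.pauliB j.succ
  U j := c.U j.succ
  clifford j := c.clifford j.succ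

lemma evolution_succ (c : Circuit A B (τ + 1)) (j : Fin τ) :
    c.evolution j.succ = c.tail.evolution j := by
  simp [evolution, tail, List.ofFn_succ]

lemma pauli_succ (c : Circuit A B (τ + 1)) (j : Fin τ) : c.pauli j.succ = c.tail.pauli j := by
  rw [pauli, evolution_succ]
  rfl

lemma seqProj_succ (c : Circuit A B (τ + 1)) (m : SignVec (τ + 1)) :
    c.seqProj m = c.tail.seqProj (fun j => m j.succ) * proj (c.pauli 0) (m 0) := by
  rw [seqProj, reverse_prod_ofFn_succ]
  simp only [pauli_succ]
  rfl

lemma proj_conj {W : Op A B} (hW : W ∈ Matrix.unitaryGroup (Qubits A × Qubits B) ℂ) (Q : Op A B)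
    (m : ℤˣ) : proj (W * Q * W.conjTranspose) m * W = W * proj Q m := by
  have h : W.conjTranspose * W = 1 := Matrix.mem_unitaryGroup_iff'.mp hW
  simp only [proj, smul_mul_assoc, mul_smul_comm, add_mul, mul_add, one_mul, mul_one]
  rw [mul_assoc _ _ W, h, mul_one]

/-- The circuit measures the time-evolved operators and applies the evolution. -/
lemma kraus_eq (m : SignVec τ) :
    c.kraus m = c.seqProj m * (List.ofFn c.U).reverse.prod := by
  induction τ with
  | zero => simp [kraus, seqProj]
  | succ τ ih =>
    have h0 : (List.ofFn c.U).reverse.prod = c.evolution 0 := by simp [evolution]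
    have h1 : c.evolution 0 = (List.ofFn c.tail.U).reverse.prod * c.U 0 := by
      rw [← h0, reverse_prod_ofFn_succ]
      rfl
    -- The first evolved observable is conjugated by the whole evolution, so its projector moves to
    -- the right of all unitaries, where it becomes the first local measurement.
    rw [h0, seqProj_succ, mul_assoc, pauli, proj_conj (c.isClifford_evolution 0).1, h1, kraus,
      reverse_prod_ofFn_succ]
    have := ih c.tail fun j => m j.succ
    rw [mul_assoc _ (c.U 0), ← mul_assoc (c.tail.seqProj _), ← this]
    rfl

lemma kraus_mul_conjTranspose (m : SignVec τ) :
    c.kraus m * (c.kraus m).conjTranspose = c.seqProj m * (c.seqProj m).conjTranspose := by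
  have h : IsClifford (List.ofFn c.U).reverse.prod := isClifford_list_prod fun U hU => by
    obtain ⟨i, rfl⟩ := (List.mem_ofFn' _ _).mp (List.mem_reverse.mp hU)
    exact c.clifford i
  rw [kraus_eq, Matrix.conjTranspose_mul, mul_assoc, ← mul_assoc _ _ (c.seqProj m).conjTranspose,
    show (List.ofFn c.U).reverse.prod * (List.ofFn c.U).reverse.prod.conjTranspose = 1 from
      Matrix.mem_unitaryGroup_iff.mp h.1, one_mul]

end Circuit
end Clifford
end Monitored

/-! ### Products of measured observables and their commutation signs. -/

namespace Monitored

variable {A B : Type*} [Fintype A] [DecidableEq A] [Fintype B] [DecidableEq B]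

/-- The sign by which two Pauli strings on `AB` commute. -/
def commAB (g h : PauliString A × PauliString B) : ℤˣ := comm g.1 h.1 * comm g.2 h.2

lemma exists_pauliOpAB_mul (g h : PauliString A × PauliString B) :
    ∃ z : ℂ, pauliOpAB g.1 g.2 * pauliOpAB h.1 h.2 = z • pauliOpAB (g * h).1 (g * h).2 := by
  obtain ⟨z, -, hz⟩ := exists_pauliOp_mul g.1 h.1
  obtain ⟨w, -, hw⟩ := exists_pauliOp_mul g.2 h.2
  refine ⟨z * w, ?_⟩
  rw [pauliOpAB, pauliOpAB, ← Matrix.mul_kronecker_mul, hz, hw, Matrix.smul_kronecker,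
    Matrix.kronecker_smul, smul_smul]
  rfl

lemma pauliOpAB_one {A B : Type*} [Fintype A] [Fintype B] :
    pauliOpAB (1 : PauliString A) (1 : PauliString B) = 1 := by
  rw [pauliOpAB, pauliOp_one, pauliOp_one]
  exact Matrix.one_kronecker_one

lemma pauliOpAB_mul_self (p : PauliString A) (q : PauliString B) :
    pauliOpAB p q * pauliOpAB p q = 1 := by
  rw [pauliOpAB, ← Matrix.mul_kronecker_mul, pauliOp_mul_self, pauliOp_mul_self]
  exact Matrix.one_kronecker_one

lemma pauliOpAB_mul_comm (g h : PauliString A × PauliString B) :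
    pauliOpAB g.1 g.2 * pauliOpAB h.1 h.2 =
      signC (commAB g h) • (pauliOpAB h.1 h.2 * pauliOpAB g.1 g.2) := by
  rw [pauliOpAB, pauliOpAB, ← Matrix.mul_kronecker_mul, ← Matrix.mul_kronecker_mul,
    pauliOp_mul_comm, pauliOp_mul_comm g.2, Matrix.smul_kronecker, Matrix.kronecker_smul, smul_smul,
    commAB, signC_mul]

lemma conjTranspose_pauliOpAB {A B : Type*} [Fintype A] [Fintype B] (p : PauliString A)
    (q : PauliString B) :
    (pauliOpAB p q).conjTranspose = pauliOpAB p q := by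
  rw [pauliOpAB, Matrix.conjTranspose_kronecker, conjTranspose_pauliOp, conjTranspose_pauliOp]

/-- Scalars do not affect commutation. Anticommuting strings cannot also commute: their product
would vanish, although both square to the identity. -/
lemma commSign_smul_pauliOpAB (e f : ℤˣ) (g h : PauliString A × PauliString B) :
    commSign (signC e • pauliOpAB g.1 g.2) (signC f • pauliOpAB h.1 h.2) = commAB g h := by
  have hc := pauliOpAB_mul_comm g h
  have hs (k : ℤˣ) : signC k ≠ 0 := by
    rw [← norm_ne_zero_iff, norm_signC]
    exact one_ne_zero
  have hiff : (signC e • pauliOpAB g.1 g.2) * (signC f • pauliOpAB h.1 h.2) =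
      (signC f • pauliOpAB h.1 h.2) * (signC e • pauliOpAB g.1 g.2) ↔
      pauliOpAB g.1 g.2 * pauliOpAB h.1 h.2 = pauliOpAB h.1 h.2 * pauliOpAB g.1 g.2 := by
    rw [smul_mul_smul_comm, smul_mul_smul_comm, mul_comm (signC f)]
    exact (smul_right_injective _ (mul_ne_zero (hs e) (hs f))).eq_iff
  rw [commSign, if_congr hiff rfl rfl]
  rcases Int.units_eq_one_or (commAB g h) with h1 | h1
  · rw [h1, signC_one, one_smul] at hc
    rw [if_pos hc, h1]
  · rw [h1, if_neg]
    intro heq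
    rw [heq, h1, signC_neg, signC_one, neg_smul, one_smul] at hc
    replace hc : pauliOpAB h.1 h.2 * pauliOpAB g.1 g.2 = 0 := by
      ext x y
      exact self_eq_neg.mp (congrFun (congrFun hc x) y)
    have : pauliOpAB h.1 h.2 * (pauliOpAB h.1 h.2 * pauliOpAB g.1 g.2) * pauliOpAB g.1 g.2 = 1 := by
      rw [← mul_assoc, pauliOpAB_mul_self, one_mul, pauliOpAB_mul_self]
    rw [hc, mul_zero, zero_mul] at this
    exact zero_ne_one this

/-- The square of a product of measured operators that pairs trivially with all error vectors. -/
lemma seqPow_mul_self {n : ℕ} (P : Fin n → Op A B) (E : Fin n → SignVec n)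
    (hsq : ∀ j, P j * P j = 1)
    (hcomm : ∀ j i, i < j → P j * P i = signC (E j i) • (P i * P j))
    (hE : ∀ j i, j ≤ i → E j i = 1) {S : Fin n → ZMod 2} (hS : ∀ j, chi S (E j) = 1) :
    seqPow P S * seqPow P S = 1 := by
  induction n with
  | zero => simp [seqPow]
  | succ n ih =>
    induction S using Fin.snocCases with
    | _ S t =>
      simp only [chi_snoc, Fin.forall_fin_succ', hE _ _ (Fin.le_last _), one_pow, mul_one] at hS
      have h := ih (fun j => P j.castSucc) (fun j i => E j.castSucc i.castSucc)
        (fun j => hsq _) (fun j i h => hcomm _ _ (by simpa using h))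
        (fun j i h => hE _ _ (by simpa using h)) hS.1
      have h1 := mul_seqPow_of_comm (fun i => hcomm _ _ (Fin.castSucc_lt_last i)) S
      -- The last observable commutes with the product of the earlier ones, so the square factors.
      rw [hS.2, signC_one, one_smul] at h1
      rw [seqPow_snoc]
      have h2 : Commute (P (Fin.last n) ^ t.val) (seqPow (fun j => P j.castSucc) S) :=
        Commute.pow_left h1 _
      rw [h2.symm.mul_mul_mul_comm, h, mul_one, ← pow_val_add (hsq _), CharTwo.add_self_eq_zero,
        ZMod.val_zero, pow_zero]

namespace Circuit

variable {τ : ℕ} (c : Circuit A B τ)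

/-- The sign of the measured operator `P_j`. -/
noncomputable def pauliSign (j : Fin τ) : ℤˣ := (c.exists_pauli_eq j).choose

/-- The Pauli string of the measured operator `P_j`. -/
noncomputable def pauliString (j : Fin τ) : PauliString A × PauliString B :=
  (c.exists_pauli_eq j).choose_spec.choose

lemma pauli_eq (j : Fin τ) :
    c.pauli j = signC (c.pauliSign j) • pauliOpAB (c.pauliString j).1 (c.pauliString j).2 :=
  (c.exists_pauli_eq j).choose_spec.choose_spec

lemma pauli_mul_self (j : Fin τ) : c.pauli j * c.pauli j = 1 := by
  rw [pauli_eq, smul_mul_smul_comm, signC_mul_self, pauliOpAB_mul_self, one_smul]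

lemma conjTranspose_pauli (j : Fin τ) : (c.pauli j).conjTranspose = c.pauli j := by
  rw [pauli_eq, Matrix.conjTranspose_smul, conjTranspose_pauliOpAB]
  exact congrArg (· • _) (conj_signC _)

lemma commSign_pauli (i j : Fin τ) :
    commSign (c.pauli i) (c.pauli j) = commAB (c.pauliString i) (c.pauliString j) := by
  rw [pauli_eq, pauli_eq, commSign_smul_pauliOpAB]

lemma pauli_mul_pauli {i j : Fin τ} (h : i < j) :
    c.pauli j * c.pauli i = signC (c.errorVec j i) • (c.pauli i * c.pauli j) := by
  rw [errorVec, if_pos h.le, commSign_pauli, pauli_eq, pauli_eq, smul_mul_smul_comm,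
    smul_mul_smul_comm, pauliOpAB_mul_comm, smul_comm, mul_comm (signC (c.pauliSign j))]

lemma errorVec_eq_one {j i : Fin τ} (h : j ≤ i) : c.errorVec j i = 1 := by
  rcases h.eq_or_lt with rfl | h
  · simp [errorVec, commSign]
  · simp [errorVec, h.not_ge]

lemma codeword_apply (p : PauliString A) (j : Fin τ) :
    c.codeword p j = comm p (c.pauliString j).1 := by
  have := commSign_smul_pauliOpAB 1 (c.pauliSign j) (p, 1) (c.pauliString j)
  rw [signC_one, one_smul, ← pauli_eq] at this
  refine this.trans ?_
  rw [commAB, comm_one_left, mul_one]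

lemma codeword_mul (p q : PauliString A) : c.codeword (p * q) = c.codeword p * c.codeword q := by
  ext j
  simp [codeword_apply, comm_mul_left]

lemma codeword_one : c.codeword 1 = 1 := by
  ext j
  simp [codeword_apply, comm_one_left]

/-- The Pauli string on `A` of the product of the measured operators `P_j` with `S j = 1`. -/
noncomputable def stringPow (S : Fin τ → ZMod 2) : PauliString A × PauliString B :=
  ∏ j, c.pauliString j ^ (S j).val

/-- The bridge from operators to the classical code. Both sides are products over `S` of the signs
between `q` and the `A`-parts of the measured strings. -/
lemma comm_stringPow (S : Fin τ → ZMod 2) (q : PauliString A) :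
    comm (c.stringPow S).1 q = chi S (c.codeword q) := by
  let f : PauliString A × PauliString B →* ℤˣ :=
    ⟨⟨fun g => comm g.1 q, comm_one_left q⟩, fun g h => comm_mul_left _ _ _⟩
  change f (∏ j, _) = _
  simp only [map_prod, map_pow, chi, codeword_apply, comm_comm q]
  rfl

lemma exists_list_prod_eq {n : ℕ} (P : Fin n → Op A B) (g : Fin n → PauliString A × PauliString B)
    (h : ∀ j, ∃ z : ℂ, P j = z • pauliOpAB (g j).1 (g j).2) :
    ∃ z : ℂ, (List.ofFn P).reverse.prod = z • pauliOpAB (∏ j, g j).1 (∏ j, g j).2 := by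
  induction n with
  | zero => exact ⟨1, by simp [pauliOpAB_one]⟩
  | succ n ih =>
    obtain ⟨z, hz⟩ := ih (fun j => P j.castSucc) (fun j => g j.castSucc) fun j => h _
    obtain ⟨w, hw⟩ := h (Fin.last n)
    obtain ⟨v, hv⟩ := exists_pauliOpAB_mul (g (Fin.last n)) (∏ j : Fin n, g j.castSucc)
    refine ⟨w * z * v, ?_⟩
    rw [reverse_prod_ofFn_castSucc, hz, hw, smul_mul_smul_comm, hv, smul_smul,
      Fin.prod_univ_castSucc, mul_comm (g _)]

lemma exists_seqPow_eq (S : Fin τ → ZMod 2) :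
    ∃ z : ℂ, seqPow c.pauli S = z • pauliOpAB (c.stringPow S).1 (c.stringPow S).2 := by
  refine exists_list_prod_eq _ _ fun j => ?_
  rcases zmod_two_eq_zero_or_one (S j) with h | h
  · exact ⟨1, by simp [h, pauliOpAB_one]⟩
  · exact ⟨signC (c.pauliSign j), by simp [h, ZMod.val_one, c.pauli_eq j]⟩

lemma mem_annihilator_errorGroup {S : Fin τ → ZMod 2} :
    S ∈ annihilator c.errorGroup ↔ ∀ j, chi S (c.errorVec j) = 1 :=
  mem_annihilator_closure _

/-- The operators in the stabilizer group are Pauli operators up to a sign. -/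
lemma exists_sign_seqPow_eq {S : Fin τ → ZMod 2} (hS : S ∈ annihilator c.errorGroup) :
    ∃ z : ℂ, z * z = 1 ∧
      seqPow c.pauli S = z • pauliOpAB (c.stringPow S).1 (c.stringPow S).2 := by
  obtain ⟨z, hz⟩ := c.exists_seqPow_eq S
  refine ⟨z, ?_, hz⟩
  have h := seqPow_mul_self c.pauli c.errorVec c.pauli_mul_self
    (fun j i h => c.pauli_mul_pauli h) (fun j i h => c.errorVec_eq_one h)
    (c.mem_annihilator_errorGroup.mp hS)
  rw [hz, smul_mul_smul_comm, pauliOpAB_mul_self] at h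
  have := congrFun (congrFun h 0) 0
  simpa using this

lemma seqProj_mul_conjTranspose (m : SignVec τ) :
    c.seqProj m * (c.seqProj m).conjTranspose =
      (1 / 2 : ℂ) ^ τ • ∑ S ∈ annihilator c.errorGroup, signC (chi S m) • seqPow c.pauli S := by
  classical
  rw [seqProj, seqProj_expansion c.pauli c.errorVec c.conjTranspose_pauli c.pauli_mul_self
    (fun j i h => c.pauli_mul_pauli h) (fun j i h => c.errorVec_eq_one h), ← Finset.sum_filter]
  congr 2
  ext S
  simp [mem_annihilator_errorGroup]

/-- Summing over the outcomes with a fixed syndrome leaves the diagonal terms of the expansion. -/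
lemma sum_seqProj_mul (s : SignVec τ) (x y x' y' : Qubits A × Qubits B) :
    ∑ m, (c.seqProj m * (c.seqProj m).conjTranspose) x y *
        (c.seqProj (m * s) * (c.seqProj (m * s)).conjTranspose) x' y' =
      (1 / 2 : ℂ) ^ τ * ∑ S ∈ annihilator c.errorGroup,
        signC (chi S s) * (seqPow c.pauli S x y * seqPow c.pauli S x' y') := by
  have h (m : SignVec τ) : (c.seqProj m * (c.seqProj m).conjTranspose) x y *
        (c.seqProj (m * s) * (c.seqProj (m * s)).conjTranspose) x' y' =
      (1 / 2 : ℂ) ^ τ * (1 / 2 : ℂ) ^ τ * ∑ S ∈ annihilator c.errorGroup,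
        ∑ T ∈ annihilator c.errorGroup, signC (chi (S + T) m) *
          (signC (chi T s) * (seqPow c.pauli S x y * seqPow c.pauli T x' y')) := by
    rw [seqProj_mul_conjTranspose, seqProj_mul_conjTranspose]
    simp only [Matrix.smul_apply, Matrix.sum_apply, smul_eq_mul]
    rw [mul_mul_mul_comm, Finset.sum_mul_sum]
    congr 1
    refine Finset.sum_congr rfl fun S _ => Finset.sum_congr rfl fun T _ => ?_
    rw [chi_add, chi_mul, signC_mul, signC_mul]
    ring
  have hST (S T : Fin τ → ZMod 2) : S + T = 0 ↔ S = T := by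
    rw [add_eq_zero_iff_eq_neg]
    have : -T = T := funext fun i => ZMod.neg_eq_self_mod_two _
    rw [this]
  simp only [h]
  rw [← Finset.mul_sum, Finset.sum_comm, mul_assoc]
  congr 1
  rw [Finset.mul_sum]
  refine Finset.sum_congr rfl fun S hS => ?_
  rw [Finset.sum_comm]
  simp only [← Finset.sum_mul, sum_signC_chi, hST, ite_mul, zero_mul]
  rw [Finset.sum_ite_eq, if_pos hS, ← mul_assoc, ← mul_pow]
  norm_num

end Circuit
end Monitored

/-! ### Normalisation and Choi states. -/

namespace Monitored

section Kets

variable {ι : Type*} [Fintype ι]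

lemma normSq_nonneg (ψ : ι → ℂ) : 0 ≤ normSq ψ := Finset.sum_nonneg fun _ _ => sq_nonneg _

lemma eq_zero_of_normSq_eq_zero {ψ : ι → ℂ} (h : normSq ψ = 0) : ψ = 0 := by
  funext i
  have := (Finset.sum_eq_zero_iff_of_nonneg fun _ _ => sq_nonneg _).mp h i (Finset.mem_univ i)
  simpa using this

lemma coe_normSq (ψ : ι → ℂ) : (normSq ψ : ℂ) = ∑ i, ψ i * conj (ψ i) := by
  simp [normSq, Complex.mul_conj, Complex.normSq_eq_norm_sq]

/-- At `p = 0` the inverse takes its default value `0`; `h0` makes the right side vanish too. -/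
lemma mul_inv_sqrt_mul_conj {p : ℝ} (hp : 0 ≤ p) {z w : ℂ} (h0 : p = 0 → z = 0) :
    (p : ℂ) * ((((√p : ℝ) : ℂ)⁻¹ * z) * conj (((√p : ℝ) : ℂ)⁻¹ * w)) = z * conj w := by
  rcases eq_or_ne p 0 with h | h
  · simp [h0 h]
  · have hs : ((√p : ℝ) : ℂ) * ((√p : ℝ) : ℂ) = p := by
      rw [← Complex.ofReal_mul, Real.mul_self_sqrt hp]
    have hne : ((√p : ℝ) : ℂ) ≠ 0 := by
      rw [Complex.ofReal_ne_zero]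
      exact (Real.sqrt_pos.mpr (hp.lt_of_ne' h)).ne'
    rw [map_mul, map_inv₀, Complex.conj_ofReal, ← hs]
    field_simp

lemma normSq_mul_normalize (ψ : ι → ℂ) (i j : ι) :
    (normSq ψ : ℂ) * (normalize ψ i * conj (normalize ψ j)) = ψ i * conj (ψ j) :=
  mul_inv_sqrt_mul_conj (normSq_nonneg ψ) fun h => congrFun (eq_zero_of_normSq_eq_zero h) i

lemma normSq_normalize {ψ : ι → ℂ} (h : normSq ψ ≠ 0) : normSq (normalize ψ) = 1 := by
  have : (normSq ψ : ℂ) * (normSq (normalize ψ) : ℂ) = normSq ψ := by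
    rw [coe_normSq (normalize ψ), Finset.mul_sum, coe_normSq]
    exact Finset.sum_congr rfl fun i _ => by rw [← coe_normSq, normSq_mul_normalize]
  exact_mod_cast mul_left_cancel₀ (Complex.ofReal_ne_zero.mpr h) (this.trans (mul_one _).symm)

lemma inv_sqrt_card_mul (n : ℕ) :
    ((√(n : ℝ) : ℝ) : ℂ)⁻¹ * ((√(n : ℝ) : ℝ) : ℂ)⁻¹ = (n : ℂ)⁻¹ := by
  rw [← mul_inv, ← Complex.ofReal_mul, Real.mul_self_sqrt (Nat.cast_nonneg n),
    Complex.ofReal_natCast]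

lemma kronecker_one_mulVec_epr {ι : Type*} [Fintype ι] [DecidableEq ι] (K : Matrix ι ι ℂ)
    (x : ι × ι) :
    (K ⊗ₖ (1 : Matrix ι ι ℂ)).mulVec (epr ι) x =
      K x.1 x.2 * ((√(Fintype.card ι : ℝ) : ℝ) : ℂ)⁻¹ := by
  simp only [Matrix.mulVec, dotProduct, Fintype.sum_prod_type, epr]
  rw [Finset.sum_eq_single x.2]
  · rw [Finset.sum_eq_single x.2]
    · simp
    · intro b _ hb
      simp [hb.symm]
    · simp
  · intro b _ hb
    rw [Finset.sum_eq_single x.2]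
    · simp [hb]
    · intro b _ hb
      simp [hb.symm]
    · simp
  · simp

lemma ketBra_smul {ι : Type*} {z : ℂ} (hz : ‖z‖ = 1) (ψ : ι → ℂ) :
    ketBra (fun i => z * ψ i) = ketBra ψ := by
  ext i j
  simp only [ketBra, Matrix.of_apply, map_mul]
  rw [mul_mul_mul_comm, Complex.mul_conj, Complex.normSq_eq_norm_sq, hz]
  simp

end Kets

section Choi

variable {A : Type*} [Fintype A] [DecidableEq A]

lemma choi_apply (p : PauliString A) (x : Qubits A × Qubits A) :
    choi p x = pauliOp p x.1 x.2 * ((√(Fintype.card (Qubits A) : ℝ) : ℝ) : ℂ)⁻¹ :=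
  kronecker_one_mulVec_epr _ x

lemma choi_one : choi (1 : PauliString A) = epr (Qubits A) := by
  funext x
  rw [choi_apply, pauliOp_one, epr, Matrix.one_apply]
  split_ifs <;> simp

lemma ketBra_choi_apply (p : PauliString A) (x y : Qubits A × Qubits A) :
    ketBra (choi p) x y =
      (Fintype.card (Qubits A) : ℂ)⁻¹ * (pauliOp p x.1 x.2 * conj (pauliOp p y.1 y.2)) := by
  rw [ketBra, Matrix.of_apply, choi_apply, choi_apply, map_mul, map_inv₀, Complex.conj_ofReal,
    ← inv_sqrt_card_mul]
  ring

/-- A Pauli operator on the second half of a Choi state gives another Choi state. -/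
lemma exists_sum_pauliOp_mul_choi (p q : PauliString A) :
    ∃ z : ℂ, ‖z‖ = 1 ∧ ∀ x y, ∑ w, pauliOp q y w * choi p (x, w) = z * choi (p * q) (x, y) := by
  obtain ⟨z, hz, h⟩ := exists_pauliOp_transpose q
  obtain ⟨w, hw, h'⟩ := exists_pauliOp_mul p q
  refine ⟨z * w, by simp [hz, hw], fun x y => ?_⟩
  have := congrFun (congrFun h' x) y
  simp only [Matrix.mul_apply, Matrix.smul_apply, smul_eq_mul] at this
  simp only [choi_apply, mul_assoc]
  rw [← mul_assoc w, ← this, Finset.sum_mul, Finset.mul_sum]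
  refine Finset.sum_congr rfl fun v _ => ?_
  rw [h y v]
  ring

/-- The effect of feedback. Transposing `q` onto the first half and multiplying by `p` cost only
phases, which cancel in the rank-one operator. -/
lemma sum_sum_pauliOp_mul_ketBra_choi (p q : PauliString A) (x y : Qubits A × Qubits A) :
    ∑ z, ∑ w, pauliOp q x.2 z * conj (pauliOp q y.2 w) * ketBra (choi p) (x.1, z) (y.1, w) =
      ketBra (choi (p * q)) x y := by
  obtain ⟨x, x'⟩ := x
  obtain ⟨y, y'⟩ := y
  obtain ⟨ζ, hζ, h⟩ := exists_sum_pauliOp_mul_choi p q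
  rw [← ketBra_smul hζ (choi (p * q)),
    show ketBra (fun i => ζ * choi (p * q) i) (x, x') (y, y') =
      ζ * choi (p * q) (x, x') * conj (ζ * choi (p * q) (y, y')) from rfl, ← h, ← h, map_sum,
    Finset.sum_mul_sum]
  refine Finset.sum_congr rfl fun z _ => Finset.sum_congr rfl fun w _ => ?_
  simp only [ketBra, Matrix.of_apply, map_mul]
  ring

end Choi

/-! ### The unnormalised joint state and its reduction. -/

variable {A B : Type*} [Fintype A] [DecidableEq A] [Fintype B] [DecidableEq B]

lemma sum_registers_nested {M : Type*} [AddCommMonoid M] (f : Registers A B → M) :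
    ∑ x, f x = ∑ a, ∑ b, ∑ r, ∑ a', ∑ abar, f ⟨a, b, r, a', abar⟩ := by
  rw [← Equiv.sum_comp (Registers.equivProd A B).symm, Fintype.sum_prod_type]
  refine Finset.sum_congr rfl fun a _ => ?_
  rw [Fintype.sum_prod_type]
  refine Finset.sum_congr rfl fun b _ => ?_
  rw [Fintype.sum_prod_type]
  refine Finset.sum_congr rfl fun r _ => ?_
  rw [Fintype.sum_prod_type]
  rfl

lemma sum_registers {M : Type*} [AddCommMonoid M] (f : Registers A B → M) :
    ∑ x, f x = ∑ x : Qubits A × Qubits A, ∑ b, ∑ r, ∑ a', f ⟨x.1, b, r, a', x.2⟩ := by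
  rw [sum_registers_nested, Fintype.sum_prod_type]
  refine Finset.sum_congr rfl fun a _ => ?_
  symm
  rw [Finset.sum_comm]
  refine Finset.sum_congr rfl fun b _ => ?_
  rw [Finset.sum_comm]
  refine Finset.sum_congr rfl fun r _ => ?_
  rw [Finset.sum_comm]

/-- The trace over `R` touches only the forward factor, and that over `A'B` only the reverse one. -/
lemma sum_reorder {R K K' L L' : Type*} [Fintype R] [Fintype K] [Fintype K'] [Fintype L]
    [Fintype L'] (f : R → K → K' → ℂ) (g : L → L' → K → K' → ℂ) :
    ∑ b, ∑ r, ∑ a, ∑ k, ∑ k', f r k k' * g a b k k' =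
      ∑ k, ∑ k', (∑ r, f r k k') * ∑ x : L × L', g x.1 x.2 k k' := by
  let e : L' × R × L × K × K' ≃ K × K' × R × L × L' :=
    ⟨fun t => (t.2.2.2.1, t.2.2.2.2, t.2.1, t.2.2.1, t.1),
      fun t => (t.2.2.2.2, t.2.2.1, t.2.2.2.1, t.1, t.2.1), fun _ => rfl, fun _ => rfl⟩
  have := Fintype.sum_equiv e
    (fun t => f t.2.1 t.2.2.2.1 t.2.2.2.2 * g t.2.2.1 t.1 t.2.2.2.1 t.2.2.2.2)
    (fun t => f t.2.2.1 t.1 t.2.1 * g t.2.2.2.1 t.2.2.2.2 t.1 t.2.1) fun _ => rfl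
  simp only [Fintype.sum_prod_type] at this
  rw [this]
  refine Finset.sum_congr rfl fun k _ => Finset.sum_congr rfl fun k' _ => ?_
  simp only [Fintype.sum_prod_type]
  rw [Finset.sum_mul]
  simp only [Finset.mul_sum]

namespace Circuit

variable {τ : ℕ} (c : Circuit A B τ)

/-- The state after the reverse measurements, not normalised. -/
noncomputable def jointKet (m mbar : SignVec τ) : Registers A B → ℂ :=
  fun x => ∑ y : Qubits A × Qubits B,
    (c.seqProj mbar).conjTranspose (x.a', x.b) y *
      (c.forwardKet m ((x.a, y.2), x.r) * epr (Qubits A) (y.1, x.abar))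

lemma reverseKet_eq (m mbar : SignVec τ) (x : Registers A B) :
    c.reverseKet m mbar x = ((√(c.probForward m) : ℝ) : ℂ)⁻¹ * c.jointKet m mbar x := by
  rw [reverseKet, jointKet, Finset.mul_sum]
  refine Finset.sum_congr rfl fun y _ => ?_
  rw [withAncilla, output, normalize, probForward]
  ring

lemma jointKet_eq_zero {m : SignVec τ} (h : c.probForward m = 0) (mbar : SignVec τ)
    (x : Registers A B) : c.jointKet m mbar x = 0 := by
  simp [jointKet, eq_zero_of_normSq_eq_zero h]

/-- The two factors of `prob` undo the two normalisations. Outcomes of probability zero cause no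
exception, as their joint ket is zero. -/
lemma prob_mul_normalize (m mbar : SignVec τ) (x y : Registers A B) :
    (c.prob m mbar : ℂ) *
        (normalize (c.reverseKet m mbar) x * conj (normalize (c.reverseKet m mbar) y)) =
      c.jointKet m mbar x * conj (c.jointKet m mbar y) := by
  rw [prob, Complex.ofReal_mul, mul_assoc, normSq_mul_normalize, reverseKet_eq, reverseKet_eq]
  exact mul_inv_sqrt_mul_conj (normSq_nonneg _) fun h => c.jointKet_eq_zero h _ _

/-- The fresh EPR pairs turn `Abar` into an index of the reverse operation; the input EPR state
makes `R` the column index of the Kraus operator. -/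
lemma jointKet_apply (m mbar : SignVec τ) (x : Registers A B) :
    c.jointKet m mbar x = ((√(Fintype.card (Qubits A × Qubits B) : ℝ) : ℝ) : ℂ)⁻¹ *
      ((√(Fintype.card (Qubits A) : ℝ) : ℝ) : ℂ)⁻¹ *
        ∑ β, conj (c.seqProj mbar (x.abar, β) (x.a', x.b)) * c.kraus m (x.a, β) x.r := by
  rw [jointKet, Fintype.sum_prod_type, Finset.sum_eq_single x.abar, Finset.mul_sum]
  · refine Finset.sum_congr rfl fun β _ => ?_
    rw [forwardKet, kronecker_one_mulVec_epr, epr, if_pos rfl, Matrix.conjTranspose_apply]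
    simp only [RCLike.star_def]
    ring
  · intro y _ hy
    simp [epr, hy]
  · simp

/-- The reduced state of `A Abar` before feedback, times the probability of the outcomes. -/
lemma sum_jointKet (m mbar : SignVec τ) (a z α w : Qubits A) :
    ∑ b, ∑ r, ∑ a', c.jointKet m mbar ⟨a, b, r, a', z⟩ * conj (c.jointKet m mbar ⟨α, b, r, a', w⟩) =
      (Fintype.card (Qubits A × Qubits B) : ℂ)⁻¹ * (Fintype.card (Qubits A) : ℂ)⁻¹ *
        ∑ b, ∑ β, (c.seqProj m * (c.seqProj m).conjTranspose) (a, b) (α, β) *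
          (c.seqProj mbar * (c.seqProj mbar).conjTranspose) (w, β) (z, b) := by
  have h (b : Qubits B) (r : Qubits A × Qubits B) (a' : Qubits A) :
      c.jointKet m mbar ⟨a, b, r, a', z⟩ * conj (c.jointKet m mbar ⟨α, b, r, a', w⟩) =
      (Fintype.card (Qubits A × Qubits B) : ℂ)⁻¹ * (Fintype.card (Qubits A) : ℂ)⁻¹ *
        ∑ β, ∑ β', (c.kraus m (a, β) r * conj (c.kraus m (α, β') r)) *
          (c.seqProj mbar (w, β') (a', b) * conj (c.seqProj mbar (z, β) (a', b))) := by
    rw [jointKet_apply, jointKet_apply, map_mul, map_mul, map_inv₀, map_inv₀, Complex.conj_ofReal,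
      Complex.conj_ofReal, mul_mul_mul_comm, mul_mul_mul_comm (((√_ : ℝ) : ℂ)⁻¹), inv_sqrt_card_mul,
      inv_sqrt_card_mul, map_sum, Finset.sum_mul_sum]
    congr 1
    refine Finset.sum_congr rfl fun β _ => Finset.sum_congr rfl fun β' _ => ?_
    simp only [map_mul, Complex.conj_conj]
    ring
  simp only [h, ← Finset.mul_sum]
  congr 1
  -- The sum over `R` yields `K K†` for the Kraus operator `K`, which does not see the final
  -- unitary.
  rw [← kraus_mul_conjTranspose]
  simp only [Matrix.mul_apply, Matrix.conjTranspose_apply, RCLike.star_def]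
  exact sum_reorder (fun r β β' => c.kraus m (a, β) r * conj (c.kraus m (α, β') r))
    fun a' b β β' => c.seqProj mbar (w, β') (a', b) * conj (c.seqProj mbar (z, β) (a', b))

end Circuit
end Monitored

/-! ### Sum over outcomes at fixed syndrome, feedback and the average. -/

namespace Monitored

variable {A B : Type*} [Fintype A] [DecidableEq A] [Fintype B] [DecidableEq B]

lemma card_qubits (S : Type*) [Fintype S] [DecidableEq S] :
    Fintype.card (Qubits S) = 2 ^ Fintype.card S := by simp

lemma card_pauliString (S : Type*) [Fintype S] [DecidableEq S] :
    Fintype.card (PauliString S) = Fintype.card (Qubits S) * Fintype.card (Qubits S) := by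
  have : Fintype.card PauliLabel = 2 * 2 := rfl
  simp [this, ← mul_pow]

lemma sum_rotate {M R K L : Type*} [AddCommMonoid M] [Fintype R] [Fintype K] [Fintype L]
    (f : R → K → L → M) : ∑ r, ∑ k, ∑ l, f r k l = ∑ k, ∑ l, ∑ r, f r k l := by
  rw [Finset.sum_comm]
  exact Finset.sum_congr rfl fun _ _ => Finset.sum_comm

lemma sum_rotate₃ {M R R' R'' K L : Type*} [AddCommMonoid M] [Fintype R] [Fintype R'] [Fintype R'']
    [Fintype K] [Fintype L] (f : R → R' → R'' → K → L → M) :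
    ∑ r, ∑ r', ∑ r'', ∑ k, ∑ l, f r r' r'' k l = ∑ k, ∑ l, ∑ r, ∑ r', ∑ r'', f r r' r'' k l :=
  ((Finset.sum_congr rfl fun _ _ => Finset.sum_congr rfl fun _ _ => sum_rotate _).trans
    (Finset.sum_congr rfl fun _ _ => sum_rotate _)).trans (sum_rotate _)

/-- The `B`-factor enters only through the trace of its square, the identity. -/
lemma sum_pauliOpAB_mul {A B : Type*} [Fintype A] [Fintype B] [DecidableEq B]
    (p : PauliString A) (q : PauliString B) (a α w z : Qubits A) :
    ∑ b, ∑ β, pauliOpAB p q (a, b) (α, β) * pauliOpAB p q (w, β) (z, b) =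
      Fintype.card (Qubits B) * (pauliOp p a α * pauliOp p w z) := by
  have h : ∑ b, ∑ β, pauliOp q b β * pauliOp q β b = (Fintype.card (Qubits B) : ℂ) := by
    simp only [← Matrix.mul_apply, pauliOp_mul_self, Matrix.one_apply_eq]
    simp
  rw [← h, Finset.sum_mul]
  refine Finset.sum_congr rfl fun b _ => ?_
  rw [Finset.sum_mul]
  refine Finset.sum_congr rfl fun β _ => ?_
  simp only [pauliOpAB, Matrix.kroneckerMap_apply]
  ring

namespace Circuit

variable {τ : ℕ} (c : Circuit A B τ)

/-- The scalar in front of the Pauli string occurs twice without conjugation, so it disappears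
because its square is `1`. The rest is the Bell resolution of the `A`-part. -/
lemma sum_seqPow_mul {S : Fin τ → ZMod 2} (hS : S ∈ annihilator c.errorGroup)
    (a α w z : Qubits A) :
    ∑ b, ∑ β, seqPow c.pauli S (a, b) (α, β) * seqPow c.pauli S (w, β) (z, b) =
      Fintype.card (Qubits B) * ∑ q : PauliString A,
        signC (chi S (c.codeword q)) * ketBra (choi q) (a, z) (α, w) := by
  obtain ⟨ζ, hζ, h⟩ := c.exists_sign_seqPow_eq hS
  have h1 (x y x' y' : Qubits A × Qubits B) :
      seqPow c.pauli S x y * seqPow c.pauli S x' y' =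
        pauliOpAB (c.stringPow S).1 (c.stringPow S).2 x y *
          pauliOpAB (c.stringPow S).1 (c.stringPow S).2 x' y' := by
    rw [h, Matrix.smul_apply, Matrix.smul_apply, smul_mul_smul_comm, hζ, one_smul]
  simp only [h1, sum_pauliOpAB_mul]
  congr 1
  have hne : (2 : ℂ) ^ Fintype.card A ≠ 0 := by simp
  simp only [← comm_stringPow, ketBra_choi_apply,
    mul_left_comm (signC _) ((Fintype.card (Qubits A) : ℂ)⁻¹)]
  rw [← Finset.mul_sum, sum_comm_mul, card_qubits]
  push_cast
  rw [inv_mul_cancel_left₀ hne]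

/-- The weight of each compatible Bell state in the output for a given syndrome. -/
noncomputable def weight : ℂ :=
  (Fintype.card (Qubits A) : ℂ)⁻¹ * (Fintype.card (Qubits A) : ℂ)⁻¹ *
    ((1 / 2 : ℂ) ^ τ * (annihilator c.errorGroup).card)

open Classical in
/-- The output before feedback, summed over the outcomes with syndrome `s`. -/
lemma sum_sum_jointKet (s : SignVec τ) (a z α w : Qubits A) :
    ∑ m, ∑ b, ∑ r, ∑ a', c.jointKet m (m * s) ⟨a, b, r, a', z⟩ *
        conj (c.jointKet m (m * s) ⟨α, b, r, a', w⟩) =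
      c.weight * ∑ q : PauliString A,
        if s * c.codeword q ∈ c.errorGroup then ketBra (choi q) (a, z) (α, w) else 0 := by
  have hB : (Fintype.card (Qubits B) : ℂ) ≠ 0 := Nat.cast_ne_zero.mpr Fintype.card_ne_zero
  have h1 : ∑ m, ∑ b, ∑ β, (c.seqProj m * (c.seqProj m).conjTranspose) (a, b) (α, β) *
      (c.seqProj (m * s) * (c.seqProj (m * s)).conjTranspose) (w, β) (z, b) =
      (Fintype.card (Qubits B) : ℂ) * ((1 / 2 : ℂ) ^ τ * ∑ q : PauliString A,
        (∑ S ∈ annihilator c.errorGroup, signC (chi S (s * c.codeword q))) *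
          ketBra (choi q) (a, z) (α, w)) := by
    rw [Finset.sum_comm]
    simp only [Finset.sum_comm (s := (Finset.univ : Finset (SignVec τ))), sum_seqProj_mul]
    simp only [← Finset.mul_sum, mul_left_comm (Fintype.card (Qubits B) : ℂ)]
    congr 1
    simp only [Finset.sum_comm (t := annihilator c.errorGroup)]
    simp only [Finset.sum_mul]
    rw [Finset.sum_comm (t := annihilator c.errorGroup), Finset.mul_sum]
    refine Finset.sum_congr rfl fun S hS => ?_
    simp only [← Finset.mul_sum]
    rw [c.sum_seqPow_mul hS, mul_left_comm, Finset.mul_sum]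
    congr 1
    refine Finset.sum_congr rfl fun q _ => ?_
    rw [chi_mul, signC_mul, mul_assoc]
  -- Duality turns the sum over `S` into the membership test for `s * c.codeword q`.
  simp only [sum_jointKet, sum_annihilator, ← Finset.mul_sum] at h1 ⊢
  rw [h1, Fintype.card_prod, weight]
  push_cast
  simp only [ite_mul, zero_mul, ← mul_ite_zero, ← Finset.mul_sum]
  rw [mul_inv]
  field_simp

/-- The output for given outcomes, times their probability. -/
lemma prob_mul_sigma (D : SignVec τ → PauliString A) (m mbar : SignVec τ)
    (x y : Qubits A × Qubits A) :
    (c.prob m mbar : ℂ) * c.sigma D m mbar x y =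
      ∑ z, ∑ w, pauliOp (D (m * mbar)) x.2 z * conj (pauliOp (D (m * mbar)) y.2 w) *
        ∑ b, ∑ r, ∑ a', c.jointKet m mbar ⟨x.1, b, r, a', z⟩ *
          conj (c.jointKet m mbar ⟨y.1, b, r, a', w⟩) := by
  have h (b : Qubits B) (r : Qubits A × Qubits B) (a' : Qubits A) :
      (c.prob m mbar : ℂ) * (c.finalKet D m mbar ⟨x.1, b, r, a', x.2⟩ *
        conj (c.finalKet D m mbar ⟨y.1, b, r, a', y.2⟩)) =
      ∑ z, ∑ w, pauliOp (D (m * mbar)) x.2 z * conj (pauliOp (D (m * mbar)) y.2 w) *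
        (c.jointKet m mbar ⟨x.1, b, r, a', z⟩ * conj (c.jointKet m mbar ⟨y.1, b, r, a', w⟩)) := by
    rw [finalKet, finalKet, map_sum, Finset.sum_mul_sum, Finset.mul_sum]
    refine Finset.sum_congr rfl fun z _ => ?_
    rw [Finset.mul_sum]
    refine Finset.sum_congr rfl fun w _ => ?_
    rw [← prob_mul_normalize, map_mul]
    ring
  simp only [sigma, Matrix.of_apply, Finset.mul_sum, h]
  exact sum_rotate₃ _

open Classical in
/-- Feedback maps the Bell states compatible with a syndrome to those of the null Paulis. -/
lemma sum_syndrome {M : Type*} [AddCommMonoid M] {D : SignVec τ → PauliString A}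
    (hD : c.IsDecoder D) (s : SignVec τ) (f : PauliString A → M) :
    ∑ q, (if s * c.codeword q ∈ c.errorGroup then f (q * D s) else 0) =
      if s ∈ c.total then ∑ p ∈ c.nullPaulis, f p else 0 := by
  have hself (v : SignVec τ) : v * v = 1 := funext fun j => by simp [← sq]
  split_ifs with hs
  -- Here `s` is an error times the codeword of `D s`, so the test on `q` becomes nullity of `q * D
  -- s`.
  · obtain ⟨e, he, hes⟩ := hD s hs
    rw [nullPaulis, Finset.sum_filter]
    refine Fintype.sum_equiv (Equiv.mulRight (D s)) _ _ fun q => ?_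
    rw [Equiv.coe_mulRight, codeword_mul]
    refine if_congr ?_ rfl rfl
    nth_rw 1 [hes]
    rw [mul_assoc, Subgroup.mul_mem_cancel_left _ he, mul_comm]
  -- Outside `total` no `q` is compatible, so the arbitrary value of `D` is harmless.
  · refine Finset.sum_eq_zero fun q _ => if_neg fun h => hs ?_
    refine Set.mem_iUnion.mpr ⟨q, _, h, ?_⟩
    rw [mul_assoc, hself, mul_one]

lemma one_mem_nullPaulis : (1 : PauliString A) ∈ c.nullPaulis := by
  simp [nullPaulis, codeword_one, one_mem]

open Classical in
-- Pairs `(s, q)` with `s * c.codeword q` an error are counted by `s` and by `q`.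
lemma card_total_mul {D : SignVec τ → PauliString A} (hD : c.IsDecoder D) :
    ((Finset.univ.filter (· ∈ c.total)).card : ℂ) * c.nullPaulis.card =
      Fintype.card (PauliString A) * Nat.card c.errorGroup := by
  have h : ∑ s : SignVec τ, ∑ q : PauliString A,
      (if s * c.codeword q ∈ c.errorGroup then (1 : ℂ) else 0) =
      (Finset.univ.filter (· ∈ c.total)).card * c.nullPaulis.card := by
    rw [Finset.sum_congr rfl fun s _ => c.sum_syndrome hD s fun _ => (1 : ℂ)]
    simp [← Finset.sum_filter]
  rw [← h, Finset.sum_comm]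
  have h2 (q : PauliString A) : ∑ s : SignVec τ,
      (if s * c.codeword q ∈ c.errorGroup then (1 : ℂ) else 0) = Nat.card c.errorGroup := by
    refine (Fintype.sum_equiv (Equiv.mulRight (c.codeword q)) _
      (fun s => if s ∈ c.errorGroup then (1 : ℂ) else 0) fun _ => rfl).trans ?_
    rw [Nat.card_eq_fintype_card,
      Fintype.card_subtype]
    simp
  simp [h2]

open Classical in
lemma weight_mul_card_total {D : SignVec τ → PauliString A} (hD : c.IsDecoder D) :
    c.weight * (Finset.univ.filter (· ∈ c.total)).card = 1 / (c.nullPaulis.card : ℂ) := by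
  have h1 := c.card_total_mul hD
  have h2 := card_annihilator_mul c.errorGroup
  have hN : (c.nullPaulis.card : ℂ) ≠ 0 :=
    Nat.cast_ne_zero.mpr (Finset.card_ne_zero_of_mem c.one_mem_nullPaulis)
  have hA : (Fintype.card (Qubits A) : ℂ) ≠ 0 := Nat.cast_ne_zero.mpr Fintype.card_ne_zero
  rw [card_pauliString] at h1
  push_cast at h1
  rw [eq_div_iff hN, weight, mul_assoc, h1]
  calc _ = ((Fintype.card (Qubits A) : ℂ)⁻¹ * Fintype.card (Qubits A)) *
      ((Fintype.card (Qubits A) : ℂ)⁻¹ * Fintype.card (Qubits A)) *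
      ((1 / 2 : ℂ) ^ τ * ((annihilator c.errorGroup).card * Nat.card c.errorGroup)) := by ring
    _ = 1 := by
      rw [h2, inv_mul_cancel₀ hA, ← mul_pow]
      norm_num

theorem averageOutput_eq {D : SignVec τ → PauliString A} (hD : c.IsDecoder D) :
    c.averageOutput D =
      (1 / (c.nullPaulis.card : ℂ)) • ∑ p ∈ c.nullPaulis, ketBra (choi p) := by
  classical
  have hmm (m s : SignVec τ) : m * (m * s) = s := by
    rw [← mul_assoc, show m * m = 1 from funext fun j => by simp [← sq], one_mul]
  ext x y
  have hs (s : SignVec τ) : ∑ m, (c.prob m (m * s) : ℂ) * c.sigma D m (m * s) x y =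
      c.weight * if s ∈ c.total then ∑ p ∈ c.nullPaulis, ketBra (choi p) x y else 0 := by
    simp only [prob_mul_sigma, hmm]
    rw [← c.sum_syndrome hD s fun p => ketBra (choi p) x y, sum_rotate]
    simp only [← Finset.mul_sum, sum_sum_jointKet, mul_left_comm _ c.weight]
    congr 1
    simp only [Finset.mul_sum, mul_ite, mul_zero]
    rw [← sum_rotate]
    refine Finset.sum_congr rfl fun q _ => ?_
    split_ifs
    · exact sum_sum_pauliOp_mul_ketBra_choi q (D s) x y
    · simp
  calc c.averageOutput D x y
      = ∑ m, ∑ mbar, (c.prob m mbar : ℂ) * c.sigma D m mbar x y := by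
        simp [averageOutput, Matrix.sum_apply]
    _ = ∑ s, ∑ m, (c.prob m (m * s) : ℂ) * c.sigma D m (m * s) x y := by
        -- The substitution `mbar = m * s` groups the outcomes by syndrome.
        refine Eq.trans (Finset.sum_congr rfl fun m _ => ?_) Finset.sum_comm
        exact (Equiv.sum_comp (Equiv.mulLeft m) fun mbar =>
          (c.prob m mbar : ℂ) * c.sigma D m mbar x y).symm
    _ = _ := by
        simp only [hs]
        rw [← Finset.mul_sum, ← Finset.sum_filter, Finset.sum_const, nsmul_eq_mul, ← mul_assoc,
          c.weight_mul_card_total hD, Matrix.smul_apply, Matrix.sum_apply, smul_eq_mul]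

end Circuit
end Monitored

/-! ### Extremality of pure states and orthonormality of Choi states. -/

namespace Monitored

section RankOne

variable {ι : Type*} [Fintype ι]

/-- The overlap `⟨φ|ψ⟩` of two kets. -/
noncomputable def overlap (φ ψ : ι → ℂ) : ℂ := ∑ i, ψ i * conj (φ i)

/-- The expectation value `⟨φ|M|φ⟩`. -/
noncomputable def expect (φ : ι → ℂ) (M : Matrix ι ι ℂ) : ℂ := ∑ i, ∑ j, conj (φ i) * M i j * φ j

lemma expect_smul (φ : ι → ℂ) (z : ℂ) (M : Matrix ι ι ℂ) :
    expect φ (z • M) = z * expect φ M := by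
  simp only [expect, Matrix.smul_apply, smul_eq_mul, Finset.mul_sum]
  exact Finset.sum_congr rfl fun _ _ => Finset.sum_congr rfl fun _ _ => by ring

lemma expect_sum {κ : Type*} (s : Finset κ) (φ : ι → ℂ) (M : κ → Matrix ι ι ℂ) :
    expect φ (∑ k ∈ s, M k) = ∑ k ∈ s, expect φ (M k) := by
  simp only [expect, Matrix.sum_apply, Finset.mul_sum, Finset.sum_mul]
  symm
  rw [Finset.sum_comm]
  exact Finset.sum_congr rfl fun _ _ => Finset.sum_comm

lemma expect_ketBra (φ ψ : ι → ℂ) :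
    expect φ (ketBra ψ) = overlap φ ψ * conj (overlap φ ψ) := by
  simp only [expect, overlap, ketBra, Matrix.of_apply, map_sum, map_mul, Finset.sum_mul_sum,
    Complex.conj_conj]
  exact Finset.sum_congr rfl fun _ _ => Finset.sum_congr rfl fun _ _ => by ring

lemma trace_ketBra (ψ : ι → ℂ) : (ketBra ψ).trace = normSq ψ := by
  rw [coe_normSq]
  rfl

/-- The squared distance from the line of `φ` is linear in `ketBra ψ`, hence additive over mixtures.
-/
lemma normSq_sub_overlap {φ : ι → ℂ} (hφ : overlap φ φ = 1) (ψ : ι → ℂ) :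
    (normSq (fun i => ψ i - overlap φ ψ * φ i) : ℂ) =
      (ketBra ψ).trace - expect φ (ketBra ψ) := by
  have h : ∑ i, φ i * conj (ψ i) = conj (overlap φ ψ) := by
    simp [overlap, mul_comm]
  rw [expect_ketBra, trace_ketBra, coe_normSq, coe_normSq]
  calc _ = ∑ i, ψ i * conj (ψ i) - conj (overlap φ ψ) * ∑ i, ψ i * conj (φ i) -
        overlap φ ψ * ∑ i, φ i * conj (ψ i) +
        overlap φ ψ * conj (overlap φ ψ) * ∑ i, φ i * conj (φ i) := by
        simp only [Finset.mul_sum, ← Finset.sum_sub_distrib, ← Finset.sum_add_distrib]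
        refine Finset.sum_congr rfl fun i _ => ?_
        rw [map_sub, map_mul]
        ring
    _ = _ := by
        rw [h, show ∑ i, φ i * conj (φ i) = 1 from hφ,
          show ∑ i, ψ i * conj (φ i) = overlap φ ψ from rfl]
        ring

lemma ketBra_eq_smul {φ ψ : ι → ℂ} (hφ : overlap φ φ = 1) {z : ℂ} (h : ψ = fun i => z * φ i) :
    ketBra ψ = (normSq ψ : ℂ) • ketBra φ := by
  have hn : (normSq ψ : ℂ) = z * conj z := by
    rw [coe_normSq, ← mul_one (z * conj z), ← hφ, overlap, Finset.mul_sum, h]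
    refine Finset.sum_congr rfl fun i _ => ?_
    rw [map_mul]
    ring
  ext i j
  rw [hn]
  simp only [h, ketBra, Matrix.smul_apply, Matrix.of_apply, smul_eq_mul, map_mul]
  ring

/-- A pure state is a mixture only of itself. -/
lemma sum_ketBra_eq_of_mixture {κ K : Type*} [Fintype κ] [Fintype K] {φ : ι → ℂ}
    (hφ : overlap φ φ = 1) {p : κ → ℝ} (hp : ∀ a, 0 ≤ p a) (v : κ → K → ι → ℂ)
    (h : ∑ a, (p a : ℂ) • ∑ k, ketBra (v a k) = ketBra φ) {a : κ} (ha : p a ≠ 0) :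
    ∑ k, ketBra (v a k) = ((∑ k, normSq (v a k) : ℝ) : ℂ) • ketBra φ := by
  let w (a : κ) (k : K) : ι → ℂ := fun i => v a k i - overlap φ (v a k) * φ i
  -- Trace minus expectation in `φ` vanishes on `ketBra φ`; on the mixture it is this sum of
  -- nonnegative terms.
  have hsum : ∑ a, p a * ∑ k, normSq (w a k) = 0 := by
    have h1 : (ketBra φ).trace - expect φ (ketBra φ) = 0 := by
      rw [expect_ketBra, hφ, trace_ketBra, coe_normSq, show ∑ i, φ i * conj (φ i) = 1 from hφ]
      simp
    rw [← h] at h1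
    simp only [Matrix.trace_sum, Matrix.trace_smul, expect_sum, expect_smul, smul_eq_mul] at h1
    rw [← Complex.ofReal_eq_zero, ← h1]
    push_cast
    rw [← Finset.sum_sub_distrib]
    refine Finset.sum_congr rfl fun a _ => ?_
    rw [← mul_sub, ← Finset.sum_sub_distrib]
    congr 1
    exact Finset.sum_congr rfl fun k _ => normSq_sub_overlap hφ _
  have hnn (a : κ) : 0 ≤ ∑ k, normSq (w a k) := Finset.sum_nonneg fun k _ => normSq_nonneg _
  have ha0 : ∑ k, normSq (w a k) = 0 :=
    ((mul_eq_zero.mp ((Finset.sum_eq_zero_iff_of_nonneg fun a _ => mul_nonneg (hp a) (hnn a)).mp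
      hsum a (Finset.mem_univ a)))).resolve_left ha
  have hv (k : K) : v a k = fun i => overlap φ (v a k) * φ i := by
    have := eq_zero_of_normSq_eq_zero
      ((Finset.sum_eq_zero_iff_of_nonneg fun k _ => normSq_nonneg _).mp ha0 k (Finset.mem_univ k))
    funext i
    exact sub_eq_zero.mp (congrFun this i)
  rw [Complex.ofReal_sum, Finset.sum_smul]
  exact Finset.sum_congr rfl fun k _ => ketBra_eq_smul hφ (hv k)

end RankOne

section Orthonormal

variable {A : Type*} [Fintype A] [DecidableEq A]

/-- The overlap is the normalised trace of a product of Paulis, and nontrivial strings are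
traceless. -/
lemma overlap_choi (p q : PauliString A) :
    overlap (choi p) (choi q) = if p = q then 1 else 0 := by
  have hA : (Fintype.card (Qubits A) : ℂ) ≠ 0 := Nat.cast_ne_zero.mpr Fintype.card_ne_zero
  have h : overlap (choi p) (choi q) =
      (Fintype.card (Qubits A) : ℂ)⁻¹ * ∑ x, (pauliOp q * pauliOp p) x x := by
    simp only [overlap, Matrix.mul_apply, Fintype.sum_prod_type, Finset.mul_sum, choi_apply,
      map_mul, conj_pauliOp, map_inv₀, Complex.conj_ofReal, ← inv_sqrt_card_mul]
    exact Finset.sum_congr rfl fun _ _ => Finset.sum_congr rfl fun _ _ => by ring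
  rw [h]
  split_ifs with hpq
  · subst hpq
    simp only [pauliOp_mul_self, Matrix.one_apply_eq, Finset.sum_const, nsmul_eq_mul, mul_one]
    exact inv_mul_cancel₀ hA
  · obtain ⟨z, -, hz⟩ := exists_pauliOp_mul q p
    have hne : q * p ≠ 1 := fun h1 => hpq <| by
      rw [← mul_one p, ← h1, mul_comm q, ← mul_assoc, p.mul_self, one_mul]
    simp only [hz, Matrix.smul_apply, smul_eq_mul]
    rw [← Finset.mul_sum, sum_pauliOp_diag hne]
    simp

lemma trace_ketBra_choi (p : PauliString A) : (ketBra (choi p)).trace = 1 := by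
  rw [trace_ketBra, coe_normSq]
  exact (overlap_choi p p).trans (if_pos rfl)

lemma normSq_pauliOp_mulVec (p : PauliString A) (ψ : Qubits A → ℂ) :
    normSq (fun x => ∑ z, pauliOp p x z * ψ z) = normSq ψ := by
  rw [← Complex.ofReal_inj, coe_normSq, coe_normSq]
  simp only [map_sum, Finset.sum_mul_sum]
  rw [sum_rotate]
  refine Finset.sum_congr rfl fun z _ => ?_
  have h (w : Qubits A) : ∑ x, pauliOp p x z * ψ z * conj (pauliOp p x w * ψ w) =
      (pauliOp p * pauliOp p) w z * (ψ z * conj (ψ w)) := by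
    rw [Matrix.mul_apply, Finset.sum_mul]
    refine Finset.sum_congr rfl fun x _ => ?_
    rw [map_mul, conj_pauliOp]
    ring
  simp only [h, pauliOp_mul_self, Matrix.one_apply, ite_mul, one_mul, zero_mul]
  simp

end Orthonormal

/-! ### Recoverability criteria. -/

variable {A B : Type*} [Fintype A] [DecidableEq A] [Fintype B] [DecidableEq B]

namespace Circuit

variable {τ : ℕ} (c : Circuit A B τ)

/-- As `codeword` is a homomorphism into a group of exponent two, a collision between `p` and `q`
says that `p * q` is null. -/
lemma recoverable_iff : c.Recoverable ↔ c.nullPaulis = {1} := by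
  constructor
  · intro h
    refine Finset.eq_singleton_iff_unique_mem.mpr ⟨c.one_mem_nullPaulis, fun p hp => ?_⟩
    by_contra hne
    refine h p 1 hne 1 (one_mem _) (c.codeword p) (by simpa [nullPaulis] using hp) ?_
    rw [codeword_one, one_mul, mul_one]
  · intro h p q hpq e he f hf heq
    have hself (v : SignVec τ) : v * v = 1 := funext fun j => by simp [← sq]
    have hmem : p * q ∈ c.nullPaulis := by
      have : c.codeword (p * q) = e * f := by
        calc c.codeword (p * q) = e * (e * c.codeword p) * c.codeword q := by
              rw [codeword_mul, ← mul_assoc, hself, one_mul]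
          _ = e * f := by rw [heq, mul_assoc, mul_assoc, hself, mul_one]
      simp [nullPaulis, this, mul_mem he hf]
    rw [h, Finset.mem_singleton] at hmem
    apply hpq
    rw [← mul_one p, ← q.mul_self, ← mul_assoc, hmem, one_mul]

lemma normSq_finalKet (D : SignVec τ → PauliString A) {m mbar : SignVec τ}
    (h : c.prob m mbar ≠ 0) : normSq (c.finalKet D m mbar) = 1 := by
  rw [← normSq_normalize (right_ne_zero_of_mul h), normSq, normSq, sum_registers_nested,
    sum_registers_nested]
  refine Finset.sum_congr rfl fun a _ => Finset.sum_congr rfl fun b _ =>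
    Finset.sum_congr rfl fun r _ => Finset.sum_congr rfl fun a' _ => ?_
  exact normSq_pauliOp_mulVec (D (m * mbar))
    fun z => normalize (c.reverseKet m mbar) ⟨a, b, r, a', z⟩

/-- The component of the final state at fixed labels of the discarded registers. -/
noncomputable def branch (D : SignVec τ → PauliString A) (m mbar : SignVec τ)
    (k : Qubits B × (Qubits A × Qubits B) × Qubits A) : Qubits A × Qubits A → ℂ :=
  fun x => c.finalKet D m mbar ⟨x.1, k.1, k.2.1, k.2.2, x.2⟩

lemma sigma_eq_sum (D : SignVec τ → PauliString A) (m mbar : SignVec τ) :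
    c.sigma D m mbar = ∑ k, ketBra (c.branch D m mbar k) := by
  ext x y
  rw [Matrix.sum_apply, Fintype.sum_prod_type]
  simp only [Fintype.sum_prod_type (α₁ := Qubits A × Qubits B)]
  rfl

lemma sum_normSq_branch (D : SignVec τ → PauliString A) (m mbar : SignVec τ) :
    ∑ k, normSq (c.branch D m mbar k) = normSq (c.finalKet D m mbar) := by
  simp only [normSq]
  rw [sum_registers, Finset.sum_comm]
  refine Finset.sum_congr rfl fun x _ => ?_
  rw [Fintype.sum_prod_type]
  simp only [Fintype.sum_prod_type (α₁ := Qubits A × Qubits B)]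
  rfl

lemma prob_nonneg (m mbar : SignVec τ) : 0 ≤ c.prob m mbar :=
  mul_nonneg (normSq_nonneg _) (normSq_nonneg _)

lemma trace_averageOutput {D : SignVec τ → PauliString A} (hD : c.IsDecoder D) :
    (c.averageOutput D).trace = 1 := by
  have hN : (c.nullPaulis.card : ℂ) ≠ 0 :=
    Nat.cast_ne_zero.mpr (Finset.card_ne_zero_of_mem c.one_mem_nullPaulis)
  rw [c.averageOutput_eq hD, Matrix.trace_smul, Matrix.trace_sum]
  simp [trace_ketBra_choi, hN]

lemma averageOutput_eq_iff {D : SignVec τ → PauliString A} (hD : c.IsDecoder D) :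
    c.averageOutput D = ketBra (epr (Qubits A)) ↔ c.Recoverable := by
  rw [recoverable_iff, c.averageOutput_eq hD, ← choi_one]
  have hN : (c.nullPaulis.card : ℂ) ≠ 0 :=
    Nat.cast_ne_zero.mpr (Finset.card_ne_zero_of_mem c.one_mem_nullPaulis)
  refine ⟨fun h => ?_, fun h => by simp [h]⟩
  refine Finset.eq_singleton_iff_unique_mem.mpr ⟨c.one_mem_nullPaulis, fun p hp => ?_⟩
  by_contra hne
  -- A nontrivial null `p` has positive weight in the mixture but zero overlap with the EPR state.
  have := congrArg (expect (choi p)) h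
  simp only [expect_smul, expect_sum, expect_ketBra, overlap_choi] at this
  rw [Finset.sum_eq_single_of_mem p hp fun q _ hq => by simp [hq.symm]] at this
  simp [hne, hN] at this

lemma forall_sigma_eq_iff {D : SignVec τ → PauliString A} (hD : c.IsDecoder D) :
    (∀ m mbar : SignVec τ, c.prob m mbar ≠ 0 →
      c.sigma D m mbar = ketBra (epr (Qubits A))) ↔ c.Recoverable := by
  have hφ : overlap (epr (Qubits A)) (epr (Qubits A)) = 1 := by
    rw [← choi_one, overlap_choi, if_pos rfl]
  rw [← c.averageOutput_eq_iff hD]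
  constructor
  · intro h
    have h1 : c.averageOutput D =
        (∑ m, ∑ mbar, (c.prob m mbar : ℂ)) • ketBra (epr (Qubits A)) := by
      rw [averageOutput, Finset.sum_smul]
      refine Finset.sum_congr rfl fun m _ => ?_
      rw [Finset.sum_smul]
      refine Finset.sum_congr rfl fun mbar _ => ?_
      by_cases h0 : c.prob m mbar = 0
      · simp [h0]
      · rw [h m mbar h0]
    -- The total probability is read off from the trace of the average.
    have h2 := c.trace_averageOutput hD
    rw [h1, Matrix.trace_smul, ← choi_one, trace_ketBra_choi, smul_eq_mul, mul_one] at h2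
    rw [h1, h2, one_smul]
  · intro h m mbar hm
    have h1 : ∑ a : SignVec τ × SignVec τ, (c.prob a.1 a.2 : ℂ) •
        ∑ k, ketBra (c.branch D a.1 a.2 k) = ketBra (epr (Qubits A)) := by
      rw [← h, averageOutput, Fintype.sum_prod_type]
      simp only [sigma_eq_sum]
    -- Each `sigma` is a sum of pure branches over the discarded registers, and extremality forces
    -- every branch onto the EPR line.
    have h2 := sum_ketBra_eq_of_mixture (κ := SignVec τ × SignVec τ) hφ
      (p := fun a => c.prob a.1 a.2) (fun a => c.prob_nonneg a.1 a.2)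
      (fun a => c.branch D a.1 a.2) h1 (a := (m, mbar)) hm
    rw [sigma_eq_sum, h2]
    simp [sum_normSq_branch, c.normSq_finalKet D hm]

end Circuit
end Monitored

theorem mainTheorem3 {A B : Type*} [Fintype A] [DecidableEq A] [Fintype B] [DecidableEq B]
    {τ : ℕ} (c : Monitored.Circuit A B τ)
    (D : Monitored.SignVec τ → Monitored.PauliString A) (hD : c.IsDecoder D) :
    c.averageOutput D =
        (1 / (c.nullPaulis.card : ℂ)) •
          ∑ p ∈ c.nullPaulis, Monitored.ketBra (Monitored.choi p) ∧
    (c.averageOutput D = Monitored.ketBra (Monitored.epr (Monitored.Qubits A)) ↔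
      c.Recoverable) ∧
    ((∀ m mbar : Monitored.SignVec τ, c.prob m mbar ≠ 0 →
        c.sigma D m mbar = Monitored.ketBra (Monitored.epr (Monitored.Qubits A))) ↔
      c.Recoverable) :=
  ⟨c.averageOutput_eq hD, c.averageOutput_eq_iff hD, c.forall_sigma_eq_iff hD⟩
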